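/- Let $r\ge 0$, $n_k\ge 1$, $m_k\ge 0$ $(k=1,\dots,r)$ and $N\ge 1$ be integers, $\mathbb V=\mathbb R^{n_1\times\cdots\times n_r}$ and $\mathbb U=\mathbb R^{m_1\times\cdots\times m_r}$ with the Frobenius inner product, $n=\dim\mathbb V=\prod_k n_k$ and $m=\dim\mathbb U=\prod_k m_k$. For $\boldsymbol A=(A_1,\dots,A_r)$ with $A_k\in\mathbb R^{n_k\times m_k}$, let $F_{\boldsymbol A}:\mathbb U\to\mathbb V$ be the Tucker map $(F_{\boldsymbol A}T)_{i_1\dots i_r}=\sum_{j_1,\dots,j_r}(A_1)_{i_1j_1}\cdots(A_r)_{i_rj_r}T_{j_1\dots j_r}$, and $F_{\boldsymbol A}^*$ its adjoint. The parameters are $\theta=(\boldsymbol A,\nu,\sigma^2)$ with $\nu\in\mathbb U$ and $\sigma^2>0$; put $\mu=F_{\boldsymbol A}\nu$. In the tensor probabilistic PCA (TPCA) model with parameter $\theta$, $X=\mu+F_{\boldsymbol A}Z+\varepsilon$, where $Z\sim N(0,\mathbb I_{\mathbb U})$ and $\varepsilon\sim N(0,\sigma^2\mathbb I_{\mathbb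 V})$ are independent. Let $$p_\theta(x,z)=(2\pi)^{-m/2}e^{-\|z\|^2/2}\,(2\pi\sigma^2)^{-n/2}e^{-\|x-\mu-F_{\boldsymbol A}z\|^2/(2\sigma^2)}$$ and let $p_\theta(z\mid x)=p_\theta(x,z)/\int p_\theta(x,z')\,dz'$. For data $x^{(1)},\dots,x^{(N)}\in\mathbb V$, the EM algorithm passes from $\theta_0$ to a maximizer $\theta$, over all parameters, of $$Q(\theta\mid\theta_0)=\sum_{i=1}^N\int\log p_\theta(x^{(i)},z)\,p_{\theta_0}(z\mid x^{(i)})\,dz .$$ Given $\theta_0=(\boldsymbol A_0,\nu_0,\sigma_0^2)$ and $\mu_0=F_{\boldsymbol A_0}\nu_0$, let $M_0=F_{\boldsymbol A_0}^*F_{\boldsymbol A_0}+\sigma_0^2\mathbb I_{\mathbb U}$ and $$E_i=M_0^{-1}F_{\boldsymbol A_0}^*(x^{(i)}-\mu_0),\qquad V=\sigma_0^2M_0^{-1},\tag{E1, E2}$$ $$G(\boldsymbol A,\mu)=\tfrac1N\sum_{i=1}^N\|x^{(i)}-\mu-F_{\boldsymbol A}E_i\|^2+\operatorname{tr}(F_{\boldsymbol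 A}VF_{\boldsymbol A}^*).\tag{M}$$ The procedure passes from $\theta_0$ to $\theta=(\boldsymbol A,\nu,\sigma^2)$, with $\sigma^2>0$, as follows. First, $\boldsymbol A$ is the factor part of a minimizer of $G(\boldsymbol A,\mu)$ over all $(\boldsymbol A,\mu)$ with $\mu\in\operatorname{Im}F_{\boldsymbol A}$. Then $$\nu=(F_{\boldsymbol A}^*F_{\boldsymbol A})^{-1}F_{\boldsymbol A}^*\Bigl(\tfrac1N\sum_{i=1}^N(x^{(i)}-F_{\boldsymbol A}E_i)\Bigr)\tag{N}$$ (if $F_{\boldsymbol A}^*F_{\boldsymbol A}$ is singular, $\nu$ is instead any minimizer of $\nu\mapsto G(\boldsymbol A,F_{\boldsymbol A}\nu)$). Finally, with $\mu=F_{\boldsymbol A}\nu$, $$\sigma^2=\tfrac1{nN}\sum_{i=1}^N\|x^{(i)}-\mu-F_{\boldsymbol A}E_i\|^2+\tfrac1n\operatorname{tr}(F_{\boldsymbol A}VF_{\boldsymbol A}^*).\tag{M2}$$ Theorem. (1) Let $(X^{(i)},Z^{(i)})_{i\le N}$ be independent draws from the TPCA model with parameter $\theta_0$. Then each $(X^{(i)},Z^{(i)})$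 has Lebesgue density $p_{\theta_0}$, and almost surely $\mathbb E(Z^{(i)}\mid X^{(i)})=M_0^{-1}F_{\boldsymbol A_0}^*(X^{(i)}-\mu_0)$ and $\operatorname{Var}(Z^{(i)}\mid X^{(i)})=\sigma_0^2M_0^{-1}$. For every $\theta$ the complete-data log-likelihood $\ell(\theta)=\sum_i\log p_\theta(X^{(i)},Z^{(i)})$ is integrable, and almost surely $\mathbb E(\ell(\theta)\mid X^{(1)},\dots,X^{(N)})=Q(\theta\mid\theta_0)$, where $Q$ is evaluated at the data $X^{(1)},\dots,X^{(N)}$. (2) For all data and all $\theta_0$: $M_0$ is invertible; $p_{\theta_0}(\cdot\mid x^{(i)})$ is a probability density with mean $E_i$ and covariance $V$; the integrals defining $Q$ converge, and for every $\theta$ $$Q(\theta\mid\theta_0)=-\tfrac{N(n+m)}2\log(2\pi)-\tfrac12\sum_i\|E_i\|^2-\tfrac{nN}2\log\sigma^2-\tfrac1{2\sigma^2}\sum_i\|x^{(i)}-\mu-F_{\boldsymbol A}E_i\|^2-\tfrac N2\operatorname{tr}V-\tfrac N{2\sigma^2}\operatorname{tr}(F_{\boldsymbol A}VF_{\boldsymbol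 A}^*).$$ (3) For all data and all $\theta_0$: for fixed $\sigma^2>0$, $Q(\boldsymbol A',\nu',\sigma^2\mid\theta_0)\le Q(\boldsymbol A,\nu,\sigma^2\mid\theta_0)$ if and only if $G(\boldsymbol A,F_{\boldsymbol A}\nu)\le G(\boldsymbol A',F_{\boldsymbol A'}\nu')$. For fixed $\sigma^2>0$ and fixed $\boldsymbol A$ with $F_{\boldsymbol A}^*F_{\boldsymbol A}$ invertible, the unique maximizer of $Q$ in $\nu$ is (N). For fixed $\boldsymbol A,\nu$, a number $\sigma^2>0$ maximizes $Q$ over $(0,\infty)$ if and only if it is given by (M2). (4) The procedure is exactly the EM algorithm: for all data and all parameters $\theta_0,\theta$, the procedure can pass from $\theta_0$ to $\theta$ if and only if $\theta$ maximizes $Q(\cdot\mid\theta_0)$ over all parameters; hence a sequence of parameters is a run of the procedure if and only if it is a run of the EM algorithm. -/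

import Mathlib

namespace TPCA

open MeasureTheory ProbabilityTheory

noncomputable section

/-- Real tensors of format `n 0 × ⋯ × n (r-1)`, with the standard (Frobenius) inner product. -/
abbrev Tensor {r : ℕ} (n : Fin r → ℕ) : Type := EuclideanSpace ℝ (∀ k, Fin (n k))

/-- A family of factor matrices `A k`, of size `n k × m k`. -/
abbrev Factors {r : ℕ} (n m : Fin r → ℕ) : Type := ∀ k, Matrix (Fin (n k)) (Fin (m k)) ℝ

/-- The dimension of the tensor space, as a real number. -/
def dim {r : ℕ} (n : Fin r → ℕ) : ℝ := ((∏ k, n k : ℕ) : ℝ)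

variable {r : ℕ} {n m : Fin r → ℕ}

/-- The Tucker map `T ↦ A · T`. -/
def tucker (A : Factors n m) : Tensor m →ₗ[ℝ] Tensor n :=
  Matrix.toEuclideanLin (Matrix.of fun i j => ∏ k, A k (i k) (j k))

theorem tucker_apply (A : Factors n m) (T : Tensor m) (i : ∀ k, Fin (n k)) :
    tucker A T i = ∑ j : (∀ k, Fin (m k)), (∏ k, A k (i k) (j k)) * T j := by
  simp [tucker, Matrix.toLpLin_apply, Matrix.mulVec, dotProduct]

/-- The adjoint of the Tucker map. -/
abbrev tuckerAdj (A : Factors n m) : Tensor n →ₗ[ℝ] Tensor m := LinearMap.adjoint (tucker A)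

/-- The parameters `θ = (A, ν, σ²)` with `σ² > 0`. -/
structure Params {r : ℕ} (n m : Fin r → ℕ) where
  A : Factors n m
  nu : Tensor m
  sigmaSq : ℝ
  sigmaSq_pos : 0 < sigmaSq

/-- The mean `μ = A · ν`. -/
def Params.mu (θ : Params n m) : Tensor n := tucker θ.A θ.nu

/-! ### The model -/

/-- `Y` is a normal random tensor with mean `μ` and covariance operator `C`: every `⟨Y, T⟩` is
normal with mean `⟨μ, T⟩` and variance `⟨C T, T⟩`. -/
def IsNormalTensor {Ω : Type*} [MeasurableSpace Ω] (P : Measure Ω) (Y : Ω → Tensor n)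
    (μ : Tensor n) (C : Module.End ℝ (Tensor n)) : Prop :=
  Measurable Y ∧ ∀ T : Tensor n,
    P.map (fun ω => inner ℝ (Y ω) T) = gaussianReal (inner ℝ μ T) (inner ℝ (C T) T).toNNReal

/-- `X = A · ν + A · Z + ε`, with `Z` standard normal, `ε ∼ N(0, σ² I)`, and `Z`, `ε`
independent. -/
def IsTPCA {Ω : Type*} [MeasurableSpace Ω] (P : Measure Ω) (θ : Params n m)
    (X : Ω → Tensor n) (Z : Ω → Tensor m) : Prop :=
  ∃ ε : Ω → Tensor n,
    IsNormalTensor P Z 0 LinearMap.id ∧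
    IsNormalTensor P ε 0 (θ.sigmaSq • LinearMap.id) ∧
    IndepFun Z ε P ∧
    ∀ ω, X ω = θ.mu + tucker θ.A (Z ω) + ε ω

/-- `(X i, Z i)`, `i < N`, are independent draws of the complete data. -/
def IsTPCASample {Ω : Type*} [MeasurableSpace Ω] (P : Measure Ω) (θ : Params n m) {N : ℕ}
    (X : Fin N → Ω → Tensor n) (Z : Fin N → Ω → Tensor m) : Prop :=
  (∀ i, IsTPCA P θ (X i) (Z i)) ∧ iIndepFun (fun i ω => (X i ω, Z i ω)) P

/-! ### The EM algorithm for the model -/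

/-- The Lebesgue density at `x` of the isotropic normal law `N(μ, v I)`. -/
def normalDensity (v : ℝ) (μ x : Tensor n) : ℝ :=
  (2 * Real.pi * v) ^ (-(dim n / 2)) * Real.exp (-(‖x - μ‖ ^ 2 / (2 * v)))

/-- The complete-data density `p_θ(x, z) = p(z) p_θ(x | z)`. -/
def jointDensity (θ : Params n m) (x : Tensor n) (z : Tensor m) : ℝ :=
  normalDensity 1 0 z * normalDensity θ.sigmaSq (θ.mu + tucker θ.A z) x

/-- The conditional law of the latent tensor given `X = x`, with the density
`z ↦ p_θ(x, z) / ∫ p_θ(x, z') dz'`. -/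
def latentPosterior (θ : Params n m) (x : Tensor n) : Measure (Tensor m) :=
  volume.withDensity fun z =>
    ENNReal.ofReal (jointDensity θ x z / ∫ z', jointDensity θ x z')

/-- The complete-data log-likelihood. -/
def logLik {N : ℕ} (θ : Params n m) (x : Fin N → Tensor n) (z : Fin N → Tensor m) : ℝ :=
  ∑ i, Real.log (jointDensity θ (x i) (z i))

/-- The EM objective `Q(θ | θ₀) = E_{θ₀}(ℓ(θ) | data)`: the conditional expectation of the
complete-data log-likelihood at `θ`, under the parameter `θ₀`. -/
def emQ {N : ℕ} (x : Fin N → Tensor n) (θ₀ θ : Params n m) : ℝ :=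
  ∑ i, ∫ z, Real.log (jointDensity θ (x i) z) ∂(latentPosterior θ₀ (x i))

/-- `θ` is an EM update of `θ₀`: it maximizes `Q(· | θ₀)` over all parameters. -/
def IsEMStep {N : ℕ} (x : Fin N → Tensor n) (θ₀ θ : Params n m) : Prop :=
  ∀ θ' : Params n m, emQ x θ₀ θ' ≤ emQ x θ₀ θ

/-! ### The explicit procedure -/

/-- `M = F_A* F_A + σ² I`. -/
def opM (θ : Params n m) : Module.End ℝ (Tensor m) :=
  tuckerAdj θ.A ∘ₗ tucker θ.A + θ.sigmaSq • LinearMap.id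

/-- `E = M⁻¹ F_A* (x - μ)`. -/
def eMean (θ : Params n m) (x : Tensor n) : Tensor m :=
  Ring.inverse (opM θ) (tuckerAdj θ.A (x - θ.mu))

/-- `V = σ² M⁻¹`. -/
def eCov (θ : Params n m) : Module.End ℝ (Tensor m) :=
  θ.sigmaSq • Ring.inverse (opM θ)

/-- The residual sum of squares `∑ i, ‖X i - μ - F_A (E i)‖²`. -/
def rss {N : ℕ} (x : Fin N → Tensor n) (E : Fin N → Tensor m)
    (A : Factors n m) (μ : Tensor n) : ℝ :=
  ∑ i, ‖x i - μ - tucker A (E i)‖ ^ 2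

/-- `tr (F_A V F_A*)`. -/
def traceTerm (V : Module.End ℝ (Tensor m)) (A : Factors n m) : ℝ :=
  LinearMap.trace ℝ (Tensor n) (tucker A ∘ₗ V ∘ₗ tuckerAdj A)

/-- The M-step objective `N⁻¹ ∑ i, ‖X i - μ - F_A (E i)‖² + tr (F_A V F_A*)`, with
`E` and `V` computed from `θ₀`. -/
def mObjective {N : ℕ} (x : Fin N → Tensor n) (θ₀ : Params n m)
    (A : Factors n m) (μ : Tensor n) : ℝ :=
  1 / (N : ℝ) * rss x (fun i => eMean θ₀ (x i)) A μ + traceTerm (eCov θ₀) A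

/-- `F_A* F_A`. -/
def gram (A : Factors n m) : Module.End ℝ (Tensor m) := tuckerAdj A ∘ₗ tucker A

/-- `ν = (F_A* F_A)⁻¹ F_A* (N⁻¹ ∑ i, (X i - F_A (E i)))`. -/
def nuUpdate {N : ℕ} (x : Fin N → Tensor n) (θ₀ : Params n m) (A : Factors n m) : Tensor m :=
  Ring.inverse (gram A)
    (tuckerAdj A ((1 / (N : ℝ)) • ∑ i, (x i - tucker A (eMean θ₀ (x i)))))

/-- `σ² = (n N)⁻¹ ∑ i, ‖X i - μ - F_A (E i)‖² + n⁻¹ tr (F_A V F_A*)`. -/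
def sigmaSqUpdate {N : ℕ} (x : Fin N → Tensor n) (θ₀ : Params n m)
    (A : Factors n m) (μ : Tensor n) : ℝ :=
  1 / (dim n * N) * rss x (fun i => eMean θ₀ (x i)) A μ
    + 1 / dim n * traceTerm (eCov θ₀) A

/-- One round of the procedure, from `θ₀` to `θ`. First `A` comes from minimizing the M-step
objective over all `(A, μ)` with `μ = A · ν`; then `ν` is given by its formula (if `F_A* F_A` is
singular, so that the formula is not defined, `ν` is any minimizer of the objective for this `A`);
finally `σ²` is given by its formula. -/
def IsProcedureStep {N : ℕ} (x : Fin N → Tensor n) (θ₀ θ : Params n m) : Prop :=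
  (∃ ν : Tensor m, ∀ (A' : Factors n m) (ν' : Tensor m),
    mObjective x θ₀ θ.A (tucker θ.A ν) ≤ mObjective x θ₀ A' (tucker A' ν')) ∧
  (IsUnit (gram θ.A) → θ.nu = nuUpdate x θ₀ θ.A) ∧
  (¬ IsUnit (gram θ.A) → ∀ ν' : Tensor m,
    mObjective x θ₀ θ.A (tucker θ.A θ.nu) ≤ mObjective x θ₀ θ.A (tucker θ.A ν')) ∧
  θ.sigmaSq = sigmaSqUpdate x θ₀ θ.A θ.mu

end

end TPCA

open MeasureTheory ProbabilityTheory TPCA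

/-!
Write the observation as `Y = X - μ = F Z + ε`. Completing the square in the joint density of
`(Y, Z)` with the gain `K = (F* F + σ² I)⁻¹ F*` shows that the conditional law of `Z` at `Y = y`,
defined through densities, is the translate by `K y` of the one at `y = 0`, and that the residual
`Z - K Y` is independent of `Y` with the latter law. Hence conditional expectations given the
observations are integrals against this posterior. At `y = 0` the posterior is the law of a
linear image of `(Z, ε)`, so it is Gaussian, with covariance `V = σ² (F* F + σ² I)⁻¹`.

The logarithm of the joint density is quadratic, so the EM objective only involves the mean and
the covariance of the posterior; up to terms that do not depend on the new parameter it is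
`-N / 2 * (n log σ² + G / σ²)`, where `G` is the M-step objective. Maximizing it therefore means
minimizing `G`, which for fixed factors is a linear least squares problem in `ν`, and then
minimizing `s ↦ n log s + G / s`.
-/

namespace TPCA

noncomputable section

section MeasureTheory

theorem map_withDensity_comp {α β : Type*} [MeasurableSpace α] [MeasurableSpace β]
    {μ : Measure α} {ν : Measure β} {Φ : α → β} (hΦ : MeasurePreserving Φ μ ν)
    {f : β → ENNReal} (hf : Measurable f) :
    (μ.withDensity (f ∘ Φ)).map Φ = ν.withDensity f := by
  ext s hs
  rw [Measure.map_apply hΦ.measurable hs, withDensity_apply _ (hΦ.measurable hs),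
    withDensity_apply _ hs, ← hΦ.setLIntegral_comp_preimage hs hf]
  rfl

variable {Ω : Type*} [MeasurableSpace Ω] {P : Measure Ω} [IsProbabilityMeasure P]

theorem condExp_comp_prodMk_of_indepFun {α β G : Type*} [mα : MeasurableSpace α]
    [MeasurableSpace β] [StandardBorelSpace β] [Nonempty β] [NormedAddCommGroup G]
    [NormedSpace ℝ G] [CompleteSpace G] {Y : Ω → α} {W : Ω → β} (hY : Measurable Y)
    (hW : Measurable W) (hYW : IndepFun Y W P) {f : α × β → G} (hf : StronglyMeasurable f)
    (hfi : Integrable (fun ω => f (Y ω, W ω)) P) :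
    P[fun ω => f (Y ω, W ω) | mα.comap Y] =ᵐ[P] fun ω => ∫ w, f (Y ω, w) ∂(P.map W) := by
  have := Measure.isProbabilityMeasure_map (μ := P) hW.aemeasurable
  have hcond : condDistrib W Y P =ᵐ[P.map Y] Kernel.const α (P.map W) := by
    refine condDistrib_ae_eq_of_measure_eq_compProd Y hW.aemeasurable ?_
    rw [Measure.compProd_const]
    exact (indepFun_iff_map_prod_eq_prod_map_map hY.aemeasurable hW.aemeasurable).1 hYW
  filter_upwards [condExp_prod_ae_eq_integral_condDistrib hY hW.aemeasurable hf hfi,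
    ae_of_ae_map hY.aemeasurable hcond] with ω hω hcondω
  rw [hω, hcondω, Kernel.const_apply]

theorem indepFun_pi_of_iIndepFun_prodMk {ι α β : Type*} [Finite ι] [MeasurableSpace α]
    [MeasurableSpace β] {X : ι → Ω → α} {W : ι → Ω → β} (hX : ∀ i, Measurable (X i))
    (hW : ∀ i, Measurable (W i)) (h : iIndepFun (fun i ω => (X i ω, W i ω)) P)
    (hXW : ∀ i, IndepFun (X i) (W i) P) :
    IndepFun (fun ω i => X i ω) (fun ω i => W i ω) P := by
  cases nonempty_fintype ι
  have hXm : Measurable fun ω i => X i ω := measurable_pi_lambda _ hX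
  have hWm : Measurable fun ω i => W i ω := measurable_pi_lambda _ hW
  have hpair : ∀ i, Measurable fun ω => (X i ω, W i ω) := fun i => (hX i).prodMk (hW i)
  have (i : ι) := Measure.isProbabilityMeasure_map (μ := P) (hX i).aemeasurable
  have (i : ι) := Measure.isProbabilityMeasure_map (μ := P) (hW i).aemeasurable
  have hXi : iIndepFun X P := h.comp (fun _ => Prod.fst) fun _ => measurable_fst
  have hWi : iIndepFun W P := h.comp (fun _ => Prod.snd) fun _ => measurable_snd
  rw [indepFun_iff_map_prod_eq_prod_map_map hXm.aemeasurable hWm.aemeasurable,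
    hXi.map_fun_eq_pi_map fun i => (hX i).aemeasurable,
    hWi.map_fun_eq_pi_map fun i => (hW i).aemeasurable,
    ← (measurePreserving_arrowProdEquivProdArrow α β ι _ _).map_eq]
  simp_rw [← fun i => (indepFun_iff_map_prod_eq_prod_map_map (hX i).aemeasurable
    (hW i).aemeasurable).1 (hXW i)]
  rw [← h.map_fun_eq_pi_map fun i => (hpair i).aemeasurable,
    Measure.map_map (MeasurableEquiv.measurable _) (measurable_pi_lambda _ hpair)]
  rfl

end MeasureTheory

section Moments

variable {E U : Type*} [NormedAddCommGroup E] [InnerProductSpace ℝ E]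
  [NormedAddCommGroup U] [InnerProductSpace ℝ U] [FiniteDimensional ℝ U] [MeasurableSpace U]
  {ν : Measure U}

theorem integrable_norm_sub_map_sq [IsFiniteMeasure ν] (hν : MemLp id 2 ν) (c : E)
    (L : U →ₗ[ℝ] E) : Integrable (fun z => ‖c - L z‖ ^ 2) ν :=
  ((memLp_const c).sub (L.toContinuousLinearMap.comp_memLp' hν)).integrable_norm_pow two_ne_zero

variable [FiniteDimensional ℝ E] [BorelSpace U] [IsProbabilityMeasure ν] {C : Module.End ℝ U}

theorem integral_norm_map_sub_integral_sq (hν : MemLp id 2 ν)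
    (hC : ∀ S T, covarianceBilin ν S T = inner ℝ (C S) T) (L : U →ₗ[ℝ] E) :
    ∫ z, ‖L (z - ∫ w, w ∂ν)‖ ^ 2 ∂ν =
      LinearMap.trace ℝ E (L ∘ₗ C ∘ₗ LinearMap.adjoint L) := by
  let b := stdOrthonormalBasis ℝ E
  have hmem (S : U) : MemLp (fun z => inner ℝ S (z - ∫ w, w ∂ν)) 2 ν :=
    (innerSL ℝ S).comp_memLp' (hν.sub (memLp_const _))
  have hvar (S : U) : ∫ z, inner ℝ S (z - ∫ w, w ∂ν) ^ 2 ∂ν = inner ℝ (C S) S := by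
    simp only [← hC, covarianceBilin_apply hν, pow_two, id]
  simp_rw [← b.sum_sq_norm_inner_right (L _), ← LinearMap.adjoint_inner_left, Real.norm_eq_abs,
    sq_abs]
  rw [integral_finsetSum _ fun i _ => (hmem _).integrable_sq, LinearMap.trace_eq_sum_inner _ b]
  refine Finset.sum_congr rfl fun i _ => ?_
  rw [hvar, LinearMap.comp_apply, real_inner_comm, LinearMap.adjoint_inner_left]
  rfl

theorem integral_norm_sub_map_sq (hν : MemLp id 2 ν)
    (hC : ∀ S T, covarianceBilin ν S T = inner ℝ (C S) T) (c : E) (L : U →ₗ[ℝ] E) :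
    ∫ z, ‖c - L z‖ ^ 2 ∂ν =
      ‖c - L (∫ z, z ∂ν)‖ ^ 2 + LinearMap.trace ℝ E (L ∘ₗ C ∘ₗ LinearMap.adjoint L) := by
  set m := ∫ z, z ∂ν with hm
  have hid : Integrable (fun z => z) ν := hν.integrable one_le_two
  have hcentred : Integrable (fun z => z - m) ν := hid.sub (integrable_const m)
  let cross := innerSL ℝ (c - L m) ∘L L.toContinuousLinearMap
  have hcross : ∫ z, cross (z - m) ∂ν = 0 := by
    rw [cross.integral_comp_comm hcentred, integral_sub hid (integrable_const m)]
    simp [hm]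
  have hsplit (z : U) : ‖c - L z‖ ^ 2 = ‖c - L m‖ ^ 2 - 2 * cross (z - m) + ‖L (z - m)‖ ^ 2 := by
    change _ = ‖c - L m‖ ^ 2 - 2 * inner ℝ (c - L m) (L (z - m)) + ‖L (z - m)‖ ^ 2
    rw [← norm_sub_sq_real, map_sub, sub_sub_sub_cancel_right]
  have hsq : Integrable (fun z => ‖L (z - m)‖ ^ 2) ν := by
    simpa only [map_sub, norm_sub_rev] using integrable_norm_sub_map_sq hν (L m) L
  have hcrossi : Integrable (fun z => 2 * cross (z - m)) ν :=
    (cross.integrable_comp hcentred).const_mul 2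
  have hlinear : Integrable (fun z => ‖c - L m‖ ^ 2 - 2 * cross (z - m)) ν :=
    (integrable_const _).sub hcrossi
  rw [integral_congr_ae (ae_of_all ν hsplit), integral_add hlinear hsq,
    integral_sub (integrable_const _) hcrossi, integral_const_mul, hcross,
    integral_norm_map_sub_integral_sq hν hC, integral_const,
    probReal_univ, one_smul, mul_zero, sub_zero]

end Moments

section IsotropicGaussian

open Module (finrank)

variable {E : Type*} [NormedAddCommGroup E] [InnerProductSpace ℝ E] {v : ℝ}

/-- The density at `x` of the centred isotropic Gaussian law with variance `v` per coordinate. -/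
def isotropicDensity (v : ℝ) (x : E) : ℝ :=
  (2 * Real.pi * v) ^ (-(finrank ℝ E / 2 : ℝ)) * Real.exp (-(‖x‖ ^ 2 / (2 * v)))

theorem isotropicDensity_pos (hv : 0 < v) (x : E) : 0 < isotropicDensity v x := by
  unfold isotropicDensity; positivity

theorem continuous_isotropicDensity (v : ℝ) : Continuous (isotropicDensity (E := E) v) := by
  unfold isotropicDensity; fun_prop

theorem isotropicDensity_le (hv : 0 < v) (x : E) :
    isotropicDensity v x ≤ isotropicDensity v (0 : E) := by
  unfold isotropicDensity
  gcongr _ * Real.exp ?_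
  simp only [norm_zero]
  have : 0 ≤ ‖x‖ ^ 2 / (2 * v) := by positivity
  simpa

theorem log_isotropicDensity (hv : 0 < v) (x : E) :
    Real.log (isotropicDensity v x) =
      -(finrank ℝ E / 2) * (Real.log (2 * Real.pi) + Real.log v) - ‖x‖ ^ 2 / (2 * v) := by
  unfold isotropicDensity
  rw [Real.log_mul (by positivity) (by positivity), Real.log_exp, Real.log_rpow (by positivity),
    Real.log_mul (by positivity) hv.ne']
  ring

variable [FiniteDimensional ℝ E] [MeasurableSpace E] [BorelSpace E]

variable (E) in
/-- The law `N(0, v I)` on `E`, for `v ≥ 0`. -/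
def isotropicGaussian (v : ℝ) : Measure E := (stdGaussian E).map (√v • ·)

theorem charFun_isotropicGaussian (hv : 0 ≤ v) (t : E) :
    charFun (isotropicGaussian E v) t = Complex.exp (-(v * ‖t‖ ^ 2 / 2)) := by
  rw [isotropicGaussian, charFun_map_smul, charFun_stdGaussian, norm_smul, Real.norm_eq_abs,
    ← Complex.ofReal_pow, mul_pow, sq_abs, Real.sq_sqrt hv]
  push_cast
  rw [neg_div]

instance isGaussian_isotropicGaussian (v : ℝ) : IsGaussian (isotropicGaussian E v) := by
  change IsGaussian ((stdGaussian E).map (√v • ContinuousLinearMap.id ℝ E))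
  infer_instance

theorem integrable_isotropicDensity (hv : 0 < v) :
    Integrable (isotropicDensity (E := E) v) := by
  refine Integrable.const_mul (f := fun x : E => Real.exp (-(‖x‖ ^ 2 / (2 * v)))) ?_ _
  have hexponent (x : E) : -(‖x‖ ^ 2 / (2 * v)) = -(2 * v)⁻¹ * ‖x‖ ^ 2 := by ring
  simp_rw [hexponent]
  refine .of_integral_ne_zero ?_
  rw [GaussianFourier.integral_rexp_neg_mul_sq_norm (by positivity)]
  positivity

theorem integral_cexp_smul_isotropicDensity (hv : 0 < v) (t : E) :
    ∫ x, isotropicDensity v x • Complex.exp (inner ℝ x t * Complex.I) =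
      Complex.exp (-(v * ‖t‖ ^ 2 / 2)) := by
  have hb : 0 < ((1 / (2 * v) : ℝ) : ℂ).re := by rw [Complex.ofReal_re]; positivity
  have hnormalization : (((2 * Real.pi * v) ^ (-(finrank ℝ E / 2 : ℝ)) : ℝ) : ℂ) *
      (Real.pi / ((1 / (2 * v) : ℝ) : ℂ)) ^ (finrank ℝ E / 2 : ℂ) = 1 := by
    have hbase : (Real.pi / ((1 / (2 * v) : ℝ) : ℂ)) = (2 * Real.pi * v : ℝ) := by
      push_cast; field_simp
    have hexp : (finrank ℝ E / 2 : ℂ) = (finrank ℝ E / 2 : ℝ) := by push_cast; rfl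
    rw [hbase, hexp, ← Complex.ofReal_cpow (by positivity), ← Complex.ofReal_mul,
      ← Real.rpow_add (by positivity), neg_add_cancel, Real.rpow_zero, Complex.ofReal_one]
  have hintegrand (x : E) : isotropicDensity v x • Complex.exp (inner ℝ x t * Complex.I) =
      (((2 * Real.pi * v) ^ (-(finrank ℝ E / 2 : ℝ)) : ℝ) : ℂ) *
        Complex.exp (-((1 / (2 * v) : ℝ) : ℂ) * ‖x‖ ^ 2 + Complex.I * inner ℝ t x) := by
    rw [isotropicDensity, Complex.real_smul, Complex.exp_add, real_inner_comm]
    push_cast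
    ring_nf
  simp_rw [hintegrand]
  rw [integral_const_mul, GaussianFourier.integral_cexp_neg_mul_sq_norm_add hb, ← mul_assoc,
    hnormalization, one_mul, Complex.I_sq]
  push_cast
  congr 1
  field_simp
  norm_num

theorem isotropicGaussian_eq_withDensity (hv : 0 < v) :
    isotropicGaussian E v =
      volume.withDensity fun x => ENNReal.ofReal (isotropicDensity v x) := by
  have := isFiniteMeasure_withDensity_ofReal (integrable_isotropicDensity (E := E) hv).2
  have hmeas : Measurable fun x : E => ENNReal.ofReal (isotropicDensity v x) :=
    (continuous_isotropicDensity v).measurable.ennreal_ofReal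
  refine Measure.ext_of_charFun (funext fun t => ?_)
  rw [charFun_isotropicGaussian hv.le, charFun_apply,
    integral_withDensity_eq_integral_toReal_smul hmeas (by simp),
    ← integral_cexp_smul_isotropicDensity hv]
  simp only [ENNReal.toReal_ofReal (isotropicDensity_pos hv _).le]

theorem eq_isotropicGaussian_of_forall_map_inner (hv : 0 ≤ v) {ν : Measure E}
    [IsFiniteMeasure ν]
    (h : ∀ t, ν.map (inner ℝ · t) = gaussianReal 0 (v * ‖t‖ ^ 2).toNNReal) :
    ν = isotropicGaussian E v := by
  refine Measure.ext_of_charFun (funext fun t => ?_)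
  have hmarginal : charFun ν t = charFun (ν.map (inner ℝ · t)) 1 := by
    rw [charFun_apply_real, integral_map (by fun_prop) (by fun_prop), charFun_apply]
    simp
  rw [hmarginal, h, charFun_isotropicGaussian hv, charFun_gaussianReal,
    Real.coe_toNNReal _ (by positivity)]
  simp

end IsotropicGaussian

section LinearGaussianDensity

variable {E U : Type*} [NormedAddCommGroup E] [InnerProductSpace ℝ E]
  [NormedAddCommGroup U] [InnerProductSpace ℝ U] (F : U →ₗ[ℝ] E) {s : ℝ}

/-- The joint density at observed vector `y` and latent vector `z` in the model `Y = F Z + ε`,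
with `Z ∼ N(0, I)` and `ε ∼ N(0, s I)` independent. -/
def linearGaussianDensity (s : ℝ) (y : E) (z : U) : ℝ :=
  isotropicDensity 1 z * isotropicDensity s (y - F z)

theorem linearGaussianDensity_pos (hs : 0 < s) (y : E) (z : U) :
    0 < linearGaussianDensity F s y z :=
  mul_pos (isotropicDensity_pos one_pos z) (isotropicDensity_pos hs _)

variable [FiniteDimensional ℝ U]

theorem continuous_linearGaussianDensity (s : ℝ) :
    Continuous fun p : E × U => linearGaussianDensity F s p.1 p.2 := by
  have hF : Continuous F := F.continuous_of_finiteDimensional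
  have hE := continuous_isotropicDensity (E := E) s
  have hU := continuous_isotropicDensity (E := U) 1
  unfold linearGaussianDensity
  fun_prop

variable [MeasurableSpace U] [BorelSpace U]

theorem integrable_linearGaussianDensity (hs : 0 < s) (y : E) :
    Integrable (linearGaussianDensity F s y) := by
  have hcont : Continuous (linearGaussianDensity F s y) :=
    (continuous_linearGaussianDensity F s).comp (Continuous.prodMk_right y)
  refine ((integrable_isotropicDensity one_pos).mul_const (isotropicDensity s (0 : E))).mono'
    hcont.aestronglyMeasurable (ae_of_all _ fun z => ?_)
  rw [Real.norm_of_nonneg (linearGaussianDensity_pos F hs y z).le]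
  exact mul_le_mul_of_nonneg_left (isotropicDensity_le hs _) (isotropicDensity_pos one_pos z).le

theorem integral_linearGaussianDensity_pos (hs : 0 < s) (y : E) :
    0 < ∫ z, linearGaussianDensity F s y z := by
  have hpos := linearGaussianDensity_pos F hs y
  rw [integral_pos_iff_support_of_nonneg (fun z => (hpos z).le)
    (integrable_linearGaussianDensity F hs y),
    Function.support_eq_univ fun z => (hpos z).ne']
  exact Measure.measure_univ_pos.2 (NeZero.ne _)

end LinearGaussianDensity

section Precision

variable {E U : Type*} [NormedAddCommGroup E] [InnerProductSpace ℝ E]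
  [NormedAddCommGroup U] [InnerProductSpace ℝ U]
  [FiniteDimensional ℝ E] [FiniteDimensional ℝ U] (F : U →ₗ[ℝ] E) {s : ℝ}

/-- The operator `F* F + s I`: up to the factor `s`, the inverse of the covariance of the latent
vector given the observed one, in the model `Y = F Z + ε` with `Z ∼ N(0, I)` and
`ε ∼ N(0, s I)`. -/
def precision (s : ℝ) : Module.End ℝ U := LinearMap.adjoint F ∘ₗ F + s • LinearMap.id

/-- The operator `(F* F + s I)⁻¹ F*`, which sends an observation to the conditional mean of the
latent vector. -/
def gain (s : ℝ) : E →ₗ[ℝ] U := Ring.inverse (precision F s) ∘ₗ LinearMap.adjoint F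

theorem inner_precision (s : ℝ) (a b : U) :
    inner ℝ (precision F s a) b = inner ℝ (F a) (F b) + s * inner ℝ a b := by
  simp [precision, inner_add_left, LinearMap.adjoint_inner_left, inner_smul_left]

theorem inner_precision_comm (s : ℝ) (a b : U) :
    inner ℝ (precision F s a) b = inner ℝ a (precision F s b) := by
  rw [inner_precision, real_inner_comm (precision F s b) a, inner_precision,
    real_inner_comm (F b) (F a), real_inner_comm b a]

theorem isUnit_precision (hs : 0 < s) : IsUnit (precision F s) := by
  refine (LinearMap.isUnit_iff_ker_eq_bot _).2 (LinearMap.ker_eq_bot'.2 fun w hw => ?_)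
  have h := inner_precision F s w w
  rw [hw, inner_zero_left, real_inner_self_eq_norm_sq, real_inner_self_eq_norm_sq] at h
  have : ‖w‖ ^ 2 = 0 := by nlinarith [sq_nonneg ‖F w‖, sq_nonneg ‖w‖]
  simpa using this

theorem precision_inverse_apply (hs : 0 < s) (w : U) :
    precision F s (Ring.inverse (precision F s) w) = w :=
  LinearMap.congr_fun (Ring.mul_inverse_cancel _ (isUnit_precision F hs)) w

theorem inverse_precision_apply (hs : 0 < s) (w : U) :
    Ring.inverse (precision F s) (precision F s w) = w :=
  LinearMap.congr_fun (Ring.inverse_mul_cancel _ (isUnit_precision F hs)) w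

theorem inner_inverse_precision_comm (hs : 0 < s) (a b : U) :
    inner ℝ (Ring.inverse (precision F s) a) b = inner ℝ a (Ring.inverse (precision F s) b) := by
  conv_lhs => rw [← precision_inverse_apply F hs b, ← inner_precision_comm,
    precision_inverse_apply F hs]

theorem inner_gain (hs : 0 < s) (y : E) (w : U) :
    inner ℝ (gain F s y) w = inner ℝ y (F (Ring.inverse (precision F s) w)) := by
  rw [gain, LinearMap.comp_apply, inner_inverse_precision_comm F hs, LinearMap.adjoint_inner_left]

theorem inner_sub_map_gain (hs : 0 < s) (y : E) (w : U) :
    inner ℝ (y - F (gain F s y)) (F w) = s * inner ℝ (gain F s y) w := by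
  have hnormal : inner ℝ (precision F s (gain F s y)) w = inner ℝ y (F w) := by
    rw [gain, LinearMap.comp_apply, precision_inverse_apply F hs, LinearMap.adjoint_inner_left]
  rw [inner_sub_left, ← hnormal, inner_precision]
  ring

/-- The operator `s (F* F + s I)⁻¹`, the conditional covariance of the latent vector. -/
def posteriorCov (s : ℝ) : Module.End ℝ U := s • Ring.inverse (precision F s)

theorem inner_posteriorCov_comm (hs : 0 < s) (a b : U) :
    inner ℝ (posteriorCov F s a) b = inner ℝ (posteriorCov F s b) a := by
  rw [posteriorCov, LinearMap.smul_apply, LinearMap.smul_apply, real_inner_smul_left,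
    real_inner_smul_left, inner_inverse_precision_comm F hs, real_inner_comm]

theorem inner_posteriorCov_self (hs : 0 < s) (a : U) :
    inner ℝ (posteriorCov F s a) a =
      ‖s • Ring.inverse (precision F s) a‖ ^ 2 + s * ‖F (Ring.inverse (precision F s) a)‖ ^ 2 := by
  have hquad : inner ℝ (Ring.inverse (precision F s) a) a =
      ‖F (Ring.inverse (precision F s) a)‖ ^ 2 + s * ‖Ring.inverse (precision F s) a‖ ^ 2 := by
    rw [← real_inner_self_eq_norm_sq, ← real_inner_self_eq_norm_sq, ← inner_precision,
      precision_inverse_apply F hs, real_inner_comm]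
  rw [posteriorCov, LinearMap.smul_apply, real_inner_smul_left, hquad, norm_smul, mul_pow,
    Real.norm_eq_abs, sq_abs]
  ring

/-- The bilinear form `(S, T) ↦ ⟪V S, T⟫` of the conditional covariance operator `V`. -/
def posteriorCovBilin (s : ℝ) : U →L[ℝ] U →L[ℝ] ℝ :=
  innerSL ℝ ∘L LinearMap.toContinuousLinearMap (posteriorCov F s)

theorem posteriorCovBilin_isPosSemidef (hs : 0 < s) :
    (posteriorCovBilin F s).toBilinForm.IsPosSemidef := by
  refine LinearMap.BilinForm.isPosSemidef_def.2
    ⟨⟨fun a b => inner_posteriorCov_comm F hs a b⟩, ⟨fun a => ?_⟩⟩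
  change 0 ≤ inner ℝ (posteriorCov F s a) a
  rw [inner_posteriorCov_self F hs]
  positivity

theorem sub_gain_map_add (hs : 0 < s) (z : U) (e : E) :
    z - gain F s (F z + e) = s • Ring.inverse (precision F s) z - gain F s e := by
  have hz : gain F s (F z) + s • Ring.inverse (precision F s) z = z := by
    conv_rhs => rw [← inverse_precision_apply F hs z]
    simp [gain, precision]
  rw [map_add, ← sub_sub, ← eq_sub_iff_add_eq'.2 hz]

-- Completing the square in the latent variable: `gain F s y` solves the normal equation.
theorem linearGaussianDensity_add_gain (hs : 0 < s) (y : E) (w : U) :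
    linearGaussianDensity F s y (w + gain F s y) =
      linearGaussianDensity F s y (gain F s y) *
        Real.exp (-(inner ℝ (precision F s w) w / (2 * s))) := by
  have hlatent : ‖w + gain F s y‖ ^ 2 =
      ‖w‖ ^ 2 + 2 * inner ℝ (gain F s y) w + ‖gain F s y‖ ^ 2 := by
    rw [norm_add_sq_real, real_inner_comm]
  have hnoise : ‖y - F (w + gain F s y)‖ ^ 2 =
      ‖y - F (gain F s y)‖ ^ 2 - 2 * (s * inner ℝ (gain F s y) w) + ‖F w‖ ^ 2 := by
    rw [← inner_sub_map_gain F hs, ← norm_sub_sq_real, map_add, sub_sub, add_comm (F w)]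
  have hexp (a b c d e : ℝ) : a * Real.exp b * (c * Real.exp d) * Real.exp e =
      a * c * Real.exp (b + d + e) := by
    rw [Real.exp_add, Real.exp_add]; ring
  simp only [linearGaussianDensity, isotropicDensity]
  rw [hexp, hlatent, hnoise, inner_precision, real_inner_self_eq_norm_sq,
    real_inner_self_eq_norm_sq, mul_mul_mul_comm, ← Real.exp_add]
  congr 2
  field_simp
  ring

end Precision

section Posterior

variable {E U : Type*} [NormedAddCommGroup E] [InnerProductSpace ℝ E]
  [NormedAddCommGroup U] [InnerProductSpace ℝ U]
  [FiniteDimensional ℝ U] [MeasurableSpace U] [BorelSpace U] (F : U →ₗ[ℝ] E) {s : ℝ}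

/-- The conditional law of the latent vector of the model `Y = F Z + ε` given `Y = y`, defined by
normalizing the joint density. -/
def posterior (s : ℝ) (y : E) : Measure U :=
  volume.withDensity fun z =>
    ENNReal.ofReal (linearGaussianDensity F s y z / ∫ z', linearGaussianDensity F s y z')

theorem measurable_posteriorDensity (s : ℝ) (y : E) :
    Measurable fun z =>
      ENNReal.ofReal (linearGaussianDensity F s y z / ∫ z', linearGaussianDensity F s y z') :=
  (((continuous_linearGaussianDensity F s).comp
    (Continuous.prodMk_right y)).div_const _).measurable.ennreal_ofReal

theorem isProbabilityMeasure_posterior (hs : 0 < s) (y : E) :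
    IsProbabilityMeasure (posterior F s y) := by
  have hpos := integral_linearGaussianDensity_pos F hs y
  constructor
  rw [posterior, withDensity_apply _ MeasurableSet.univ, Measure.restrict_univ,
    ← ofReal_integral_eq_lintegral_ofReal ((integrable_linearGaussianDensity F hs y).div_const _)
      (ae_of_all _ fun z => div_nonneg (linearGaussianDensity_pos F hs y z).le hpos.le),
    integral_div, div_self hpos.ne', ENNReal.ofReal_one]

variable [FiniteDimensional ℝ E]

theorem linearGaussianDensity_add_gain_eq_mul_div (hs : 0 < s) (y : E) (w : U) :
    linearGaussianDensity F s y (w + gain F s y) =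
      (∫ z, linearGaussianDensity F s y z) *
        (linearGaussianDensity F s 0 w / ∫ z, linearGaussianDensity F s 0 z) := by
  have hevidence (y : E) : ∫ z, linearGaussianDensity F s y z =
      linearGaussianDensity F s y (gain F s y) *
        ∫ w, Real.exp (-(inner ℝ (precision F s w) w / (2 * s))) := by
    rw [← integral_add_right_eq_self _ (gain F s y)]
    simp_rw [linearGaussianDensity_add_gain F hs y, integral_const_mul]
  have hcentre := linearGaussianDensity_add_gain F hs 0 w
  rw [map_zero, add_zero] at hcentre
  have h0 := hevidence 0
  rw [map_zero] at h0
  have hne := (integral_linearGaussianDensity_pos F hs 0).ne'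
  rw [h0] at hne
  obtain ⟨hcentre_ne, hkernel_ne⟩ := mul_ne_zero_iff.1 hne
  rw [linearGaussianDensity_add_gain F hs, hevidence, h0, hcentre]
  field_simp

theorem posterior_eq_map_add_gain (hs : 0 < s) (y : E) :
    posterior F s y = (posterior F s 0).map (· + gain F s y) := by
  rw [posterior, ← map_withDensity_comp (measurePreserving_add_right volume (gain F s y))
    (measurable_posteriorDensity F s y), posterior]
  congr 2
  funext w
  rw [Function.comp_apply, linearGaussianDensity_add_gain_eq_mul_div F hs,
    mul_div_cancel_left₀ _ (integral_linearGaussianDensity_pos F hs y).ne']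

variable [MeasurableSpace E] [BorelSpace E]

/-- The joint law of the observed and the latent vector of the model `Y = F Z + ε`. -/
def linearGaussianLaw (s : ℝ) : Measure (E × U) :=
  (volume.prod volume).withDensity fun p => ENNReal.ofReal (linearGaussianDensity F s p.1 p.2)

theorem map_isotropicGaussian_prod (hs : 0 < s) :
    ((isotropicGaussian U 1).prod (isotropicGaussian E s)).map (fun p => (F p.1 + p.2, p.1)) =
      linearGaussianLaw F s := by
  have hF : Continuous F := F.continuous_of_finiteDimensional
  have hshear : MeasurePreserving (fun p : U × E => (F p.1 + p.2, p.1))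
      (volume.prod volume) (volume.prod volume) :=
    Measure.measurePreserving_swap.comp <|
      (MeasurePreserving.id volume).skew_product (g := fun z e => F z + e)
        (by fun_prop : Continuous fun p : U × E => F p.1 + p.2).measurable
        (ae_of_all _ fun z => (measurePreserving_add_left volume (F z)).map_eq)
  rw [linearGaussianLaw, ← map_withDensity_comp hshear
      (continuous_linearGaussianDensity F s).measurable.ennreal_ofReal,
    isotropicGaussian_eq_withDensity one_pos, isotropicGaussian_eq_withDensity hs,
    prod_withDensity (continuous_isotropicDensity 1).measurable.ennreal_ofReal
      (continuous_isotropicDensity s).measurable.ennreal_ofReal]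
  congr 2
  funext p
  rw [Function.comp_apply, linearGaussianDensity, add_sub_cancel_left,
    ENNReal.ofReal_mul (isotropicDensity_pos one_pos _).le]

theorem map_sub_gain_linearGaussianLaw (hs : 0 < s) :
    (linearGaussianLaw F s).map (fun p => (p.1, p.2 - gain F s p.1)) =
      (volume.withDensity fun y => ENNReal.ofReal (∫ z, linearGaussianDensity F s y z)).prod
        (posterior F s 0) := by
  have hK : Continuous (gain F s) := LinearMap.continuous_of_finiteDimensional _
  have hshear : MeasurePreserving (fun p : E × U => (p.1, p.2 - gain F s p.1))
      (volume.prod volume) (volume.prod volume) :=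
    (MeasurePreserving.id volume).skew_product (g := fun y z => z - gain F s y)
      (by fun_prop : Continuous fun p : E × U => p.2 - gain F s p.1).measurable
      (ae_of_all _ fun y => (measurePreserving_sub_right volume (gain F s y)).map_eq)
  have hevidence : Measurable fun y : E =>
      ENNReal.ofReal (∫ z, linearGaussianDensity F s y z) :=
    (continuous_linearGaussianDensity F s).stronglyMeasurable.integral_prod_right
      |>.measurable.ennreal_ofReal
  have hresidual := measurable_posteriorDensity F s 0
  have hproduct : Measurable fun p : E × U =>
      ENNReal.ofReal (∫ z, linearGaussianDensity F s p.1 z) *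
        ENNReal.ofReal (linearGaussianDensity F s 0 p.2 / ∫ z, linearGaussianDensity F s 0 z) :=
    (hevidence.comp measurable_fst).mul (hresidual.comp measurable_snd)
  rw [posterior, prod_withDensity hevidence hresidual, ← map_withDensity_comp hshear hproduct,
    linearGaussianLaw]
  congr 2
  funext p
  have hsquare := linearGaussianDensity_add_gain_eq_mul_div F hs p.1 (p.2 - gain F s p.1)
  rw [sub_add_cancel] at hsquare
  rw [Function.comp_apply, hsquare,
    ENNReal.ofReal_mul (integral_linearGaussianDensity_pos F hs _).le]

variable {Ω : Type*} [MeasurableSpace Ω] {P : Measure Ω} {Y : Ω → E} {Z : Ω → U}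

theorem map_prodMk_sub_gain (hs : 0 < s) (hY : Measurable Y) (hZ : Measurable Z)
    (hYZ : P.map (fun ω => (Y ω, Z ω)) = linearGaussianLaw F s) :
    P.map (fun ω => (Y ω, Z ω - gain F s (Y ω))) = (P.map Y).prod (posterior F s 0) := by
  have hK : Continuous (gain F s) := LinearMap.continuous_of_finiteDimensional _
  have hW : Measurable fun ω => Z ω - gain F s (Y ω) := hZ.sub (hK.measurable.comp hY)
  have hshear : Measurable fun p : E × U => (p.1, p.2 - gain F s p.1) := by fun_prop
  have := isProbabilityMeasure_posterior F hs 0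
  have hprod := map_sub_gain_linearGaussianLaw F hs
  rw [← hYZ, Measure.map_map hshear (hY.prodMk hZ)] at hprod
  have hevidence : P.map Y = volume.withDensity fun y =>
      ENNReal.ofReal (∫ z, linearGaussianDensity F s y z) := by
    have hfst := congrArg Measure.fst hprod
    rw [Measure.fst_prod] at hfst
    exact (Measure.fst_map_prodMk hW).symm.trans hfst
  rw [hevidence]
  exact hprod

variable [IsProbabilityMeasure P]

theorem map_sub_gain (hs : 0 < s) (hY : Measurable Y) (hZ : Measurable Z)
    (hYZ : P.map (fun ω => (Y ω, Z ω)) = linearGaussianLaw F s) :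
    P.map (fun ω => Z ω - gain F s (Y ω)) = posterior F s 0 := by
  have := Measure.isProbabilityMeasure_map (μ := P) hY.aemeasurable
  have := isProbabilityMeasure_posterior F hs 0
  have hsnd := congrArg Measure.snd (map_prodMk_sub_gain F hs hY hZ hYZ)
  rwa [Measure.snd_map_prodMk hY, Measure.snd_prod] at hsnd

theorem indepFun_sub_gain (hs : 0 < s) (hY : Measurable Y) (hZ : Measurable Z)
    (hYZ : P.map (fun ω => (Y ω, Z ω)) = linearGaussianLaw F s) :
    IndepFun Y (fun ω => Z ω - gain F s (Y ω)) P := by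
  have hK : Continuous (gain F s) := LinearMap.continuous_of_finiteDimensional _
  have hW : Measurable fun ω => Z ω - gain F s (Y ω) := hZ.sub (hK.measurable.comp hY)
  rw [indepFun_iff_map_prod_eq_prod_map_map hY.aemeasurable hW.aemeasurable,
    map_sub_gain F hs hY hZ hYZ, map_prodMk_sub_gain F hs hY hZ hYZ]

theorem charFun_posterior_zero (hs : 0 < s) (t : U) :
    charFun (posterior F s 0) t = Complex.exp (-(inner ℝ (posteriorCov F s t) t / 2 : ℝ)) := by
  have hF : Continuous F := F.continuous_of_finiteDimensional
  have hK : Continuous (gain F s) := LinearMap.continuous_of_finiteDimensional _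
  let u := Ring.inverse (precision F s) t
  have hinner (z : U) (e : E) :
      inner ℝ (z - gain F s (F z + e)) t = inner ℝ z (s • u) + inner ℝ e (-F u) := by
    rw [sub_gain_map_add F hs, inner_sub_left, real_inner_smul_left,
      inner_inverse_precision_comm F hs, inner_gain F hs, inner_neg_right, real_inner_smul_right,
      sub_eq_add_neg]
  rw [← map_sub_gain (P := (isotropicGaussian U 1).prod (isotropicGaussian E s)) F hs
      (by fun_prop) (by fun_prop) (map_isotropicGaussian_prod F hs),
    charFun_apply, integral_map (by fun_prop) (by fun_prop)]
  simp_rw [hinner, Complex.ofReal_add, add_mul, Complex.exp_add]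
  rw [integral_prod_mul (fun z => Complex.exp (inner ℝ z (s • u) * Complex.I))
      (fun e => Complex.exp (inner ℝ e (-F u) * Complex.I)), ← charFun_apply, ← charFun_apply,
    charFun_isotropicGaussian zero_le_one, charFun_isotropicGaussian hs.le, ← Complex.exp_add,
    inner_posteriorCov_self F hs, norm_neg]
  push_cast
  congr 1
  ring

theorem charFun_posterior (hs : 0 < s) (y : E) (t : U) :
    charFun (posterior F s y) t =
      Complex.exp (inner ℝ t (gain F s y) * Complex.I - posteriorCovBilin F s t t / 2) := by
  have hbilin : posteriorCovBilin F s t t = inner ℝ (posteriorCov F s t) t := rfl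
  rw [posterior_eq_map_add_gain F hs, charFun_map_add_const, charFun_posterior_zero F hs,
    ← Complex.exp_add, real_inner_comm t (gain F s y), hbilin]
  congr 1
  push_cast
  ring

theorem isGaussian_posterior (hs : 0 < s) (y : E) : IsGaussian (posterior F s y) := by
  have := isProbabilityMeasure_posterior F hs y
  exact isGaussian_iff_gaussian_charFun.2
    ⟨gain F s y, _, posteriorCovBilin_isPosSemidef F hs, charFun_posterior F hs y⟩

theorem integral_id_posterior (hs : 0 < s) (y : E) :
    ∫ z, z ∂(posterior F s y) = gain F s y := by
  have := isGaussian_posterior F hs y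
  exact (gaussian_charFun_congr _ _ (posteriorCovBilin_isPosSemidef F hs)
    (charFun_posterior F hs y)).1.symm

theorem covarianceBilin_posterior (hs : 0 < s) (y : E) (S T : U) :
    covarianceBilin (posterior F s y) S T = inner ℝ (posteriorCov F s S) T := by
  have := isGaussian_posterior F hs y
  rw [← (gaussian_charFun_congr _ _ (posteriorCovBilin_isPosSemidef F hs)
    (charFun_posterior F hs y)).2]
  rfl

end Posterior

section ConditionalExpectation

variable {E U : Type*} [NormedAddCommGroup E] [InnerProductSpace ℝ E]
  [NormedAddCommGroup U] [InnerProductSpace ℝ U]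
  [FiniteDimensional ℝ E] [FiniteDimensional ℝ U] [MeasurableSpace E] [BorelSpace E]
  [MeasurableSpace U] [BorelSpace U] (F : U →ₗ[ℝ] E) {s : ℝ}
  {Ω : Type*} [MeasurableSpace Ω] {P : Measure Ω} [IsProbabilityMeasure P]

/-- The conditioning vector `X` may carry more than the observation `g ∘ X` of the latent vector:
in the application it consists of the observations of all latent vectors of a sample. -/
theorem condExp_comp_prodMk_latent {α G : Type*} [mα : MeasurableSpace α]
    [NormedAddCommGroup G] [NormedSpace ℝ G] [CompleteSpace G] (hs : 0 < s) {X : Ω → α}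
    {g : α → E} {Z : Ω → U} (hX : Measurable X) (hg : Measurable g) (hZ : Measurable Z)
    (hXZ : P.map (fun ω => (g (X ω), Z ω)) = linearGaussianLaw F s)
    (hindep : IndepFun X (fun ω => Z ω - gain F s (g (X ω))) P) {f : α × U → G}
    (hf : StronglyMeasurable f) (hfi : Integrable (fun ω => f (X ω, Z ω)) P) :
    P[fun ω => f (X ω, Z ω) | mα.comap X] =ᵐ[P]
      fun ω => ∫ z, f (X ω, z) ∂(posterior F s (g (X ω))) := by
  have := FiniteDimensional.complete ℝ U
  have hK : Measurable (gain F s) :=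
    (LinearMap.continuous_of_finiteDimensional (gain F s)).measurable
  have hW : Measurable fun ω => Z ω - gain F s (g (X ω)) :=
    hZ.sub (hK.comp (hg.comp hX))
  have hshift : StronglyMeasurable fun p : α × U => f (p.1, p.2 + gain F s (g p.1)) :=
    hf.comp_measurable (by fun_prop)
  have hcond := condExp_comp_prodMk_of_indepFun hX hW hindep hshift
    (by simpa only [sub_add_cancel] using hfi)
  have hlaw : P.map (fun ω => Z ω - gain F s (g (X ω))) = posterior F s 0 :=
    map_sub_gain F hs (hg.comp hX) hZ hXZ
  simp only [sub_add_cancel, hlaw] at hcond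
  filter_upwards [hcond] with ω hω
  rw [hω, posterior_eq_map_add_gain F hs (g (X ω)), integral_map (by fun_prop)]
  exact (hf.comp_measurable measurable_prodMk_left).aestronglyMeasurable

end ConditionalExpectation

section LogDensity

open Module (finrank)

variable {E U : Type*} [NormedAddCommGroup E] [InnerProductSpace ℝ E]
  [NormedAddCommGroup U] [InnerProductSpace ℝ U] (F : U →ₗ[ℝ] E) {s : ℝ}

theorem log_linearGaussianDensity (hs : 0 < s) (y : E) (z : U) :
    Real.log (linearGaussianDensity F s y z) =
      -((finrank ℝ E + finrank ℝ U) / 2 * Real.log (2 * Real.pi)) - finrank ℝ E / 2 * Real.log s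
        - 1 / 2 * ‖z‖ ^ 2 - 1 / (2 * s) * ‖y - F z‖ ^ 2 := by
  rw [linearGaussianDensity, Real.log_mul (isotropicDensity_pos one_pos z).ne'
    (isotropicDensity_pos hs _).ne', log_isotropicDensity one_pos, log_isotropicDensity hs,
    Real.log_one]
  ring

variable [FiniteDimensional ℝ U]

theorem integrable_log_linearGaussianDensity {Ω : Type*} [MeasurableSpace Ω] {P : Measure Ω}
    [IsFiniteMeasure P] (hs : 0 < s) {Y : Ω → E} {Z : Ω → U} (hY : MemLp Y 2 P)
    (hZ : MemLp Z 2 P) :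
    Integrable (fun ω => Real.log (linearGaussianDensity F s (Y ω) (Z ω))) P := by
  simp only [log_linearGaussianDensity F hs]
  have hlatent : Integrable (fun ω => 1 / 2 * ‖Z ω‖ ^ 2) P :=
    (hZ.integrable_norm_pow two_ne_zero).const_mul _
  have hnoise : Integrable (fun ω => 1 / (2 * s) * ‖Y ω - F (Z ω)‖ ^ 2) P :=
    ((hY.sub (F.toContinuousLinearMap.comp_memLp' hZ)).integrable_norm_pow
      two_ne_zero).const_mul _
  exact ((integrable_const _).sub hlatent).sub hnoise

theorem integral_log_linearGaussianDensity [FiniteDimensional ℝ E] [MeasurableSpace U]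
    [BorelSpace U] {ν : Measure U} [IsProbabilityMeasure ν] {C : Module.End ℝ U} (hs : 0 < s)
    (hν : MemLp id 2 ν) (hC : ∀ S T, covarianceBilin ν S T = inner ℝ (C S) T) (y : E) :
    ∫ z, Real.log (linearGaussianDensity F s y z) ∂ν =
      -((finrank ℝ E + finrank ℝ U) / 2 * Real.log (2 * Real.pi)) - finrank ℝ E / 2 * Real.log s
        - 1 / 2 * (‖∫ z, z ∂ν‖ ^ 2 + LinearMap.trace ℝ U C)
        - 1 / (2 * s) * (‖y - F (∫ z, z ∂ν)‖ ^ 2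
          + LinearMap.trace ℝ E (F ∘ₗ C ∘ₗ LinearMap.adjoint F)) := by
  have hlatent : Integrable (fun z => 1 / 2 * ‖z‖ ^ 2) ν :=
    (hν.integrable_norm_pow two_ne_zero).const_mul _
  have hnoise := (integrable_norm_sub_map_sq hν y F).const_mul (1 / (2 * s))
  have hsecond : ∫ z, ‖z‖ ^ 2 ∂ν = ‖∫ z, z ∂ν‖ ^ 2 + LinearMap.trace ℝ U C := by
    simpa using integral_norm_sub_map_sq hν hC 0 LinearMap.id
  let c := -((finrank ℝ E + finrank ℝ U) / 2 * Real.log (2 * Real.pi)) -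
    finrank ℝ E / 2 * Real.log s
  have hprior : Integrable (fun z => c - 1 / 2 * ‖z‖ ^ 2) ν := (integrable_const c).sub hlatent
  simp only [log_linearGaussianDensity F hs]
  rw [integral_sub hprior hnoise, integral_sub (integrable_const _) hlatent, integral_const_mul,
    integral_const_mul, hsecond, integral_norm_sub_map_sq hν hC, integral_const,
    probReal_univ, one_smul]

end LogDensity

section LeastSquares

variable {ι E U : Type*} [Fintype ι] [NormedAddCommGroup E] [InnerProductSpace ℝ E]
  [NormedAddCommGroup U] [InnerProductSpace ℝ U]

theorem sum_norm_sub_sq_of_normal_equation {F : U →ₗ[ℝ] E} {y : ι → E} {ν₁ : U}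
    (h : ∀ w, inner ℝ (∑ i, (y i - F ν₁)) (F w) = 0) (ν : U) :
    ∑ i, ‖y i - F ν‖ ^ 2 = ∑ i, ‖y i - F ν₁‖ ^ 2 + Fintype.card ι * ‖F (ν - ν₁)‖ ^ 2 := by
  have hsplit (i : ι) : ‖y i - F ν‖ ^ 2 =
      ‖y i - F ν₁‖ ^ 2 - 2 * inner ℝ (y i - F ν₁) (F (ν - ν₁)) + ‖F (ν - ν₁)‖ ^ 2 := by
    rw [← norm_sub_sq_real, map_sub, sub_sub_sub_cancel_right]
  simp_rw [hsplit, Finset.sum_add_distrib, Finset.sum_sub_distrib, ← Finset.mul_sum, ← sum_inner]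
  rw [h, Finset.sum_const, Finset.card_univ, nsmul_eq_mul]
  ring

variable [FiniteDimensional ℝ E] [FiniteDimensional ℝ U]

theorem forall_sum_norm_sub_sq_le_iff [Nonempty ι] {F : U →ₗ[ℝ] E}
    (hF : IsUnit (LinearMap.adjoint F ∘ₗ F)) (y : ι → E) (ν : U) :
    (∀ ν', ∑ i, ‖y i - F ν‖ ^ 2 ≤ ∑ i, ‖y i - F ν'‖ ^ 2) ↔
      ν = Ring.inverse (LinearMap.adjoint F ∘ₗ F)
        (LinearMap.adjoint F ((1 / (Fintype.card ι : ℝ)) • ∑ i, y i)) := by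
  set ν₁ := Ring.inverse (LinearMap.adjoint F ∘ₗ F)
    (LinearMap.adjoint F ((1 / (Fintype.card ι : ℝ)) • ∑ i, y i))
  have hcard : (0 : ℝ) < Fintype.card ι := by exact_mod_cast Fintype.card_pos
  have hinj (w : U) (hw : F w = 0) : w = 0 :=
    LinearMap.ker_eq_bot'.1 ((LinearMap.isUnit_iff_ker_eq_bot _).1 hF) w
      (by rw [LinearMap.comp_apply, hw, map_zero])
  have hgram : LinearMap.adjoint F (F ν₁) =
      LinearMap.adjoint F ((1 / (Fintype.card ι : ℝ)) • ∑ i, y i) :=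
    LinearMap.congr_fun (Ring.mul_inverse_cancel _ hF) _
  have hnormal (w : U) : inner ℝ (∑ i, (y i - F ν₁)) (F w) = 0 := by
    rw [← LinearMap.adjoint_inner_left, Finset.sum_sub_distrib, map_sub, Finset.sum_const,
      Finset.card_univ, map_nsmul, hgram, map_smul, ← Nat.cast_smul_eq_nsmul ℝ, smul_smul,
      mul_one_div_cancel hcard.ne', one_smul, sub_self, inner_zero_left]
  have hexpand := sum_norm_sub_sq_of_normal_equation hnormal
  constructor
  · intro hmin
    have hle := hmin ν₁
    rw [hexpand ν] at hle
    have hzero : ‖F (ν - ν₁)‖ ^ 2 = 0 := by nlinarith [sq_nonneg ‖F (ν - ν₁)‖]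
    exact sub_eq_zero.1 (hinj _ (by simpa using hzero))
  · rintro rfl ν'
    rw [hexpand ν']
    exact le_add_of_nonneg_right (by positivity)

end LeastSquares

section LogScale

theorem forall_mul_log_add_div_le_iff {d : ℝ} (hd : 0 < d) (g : ℝ) {s : ℝ} (hs : 0 < s) :
    (∀ t, 0 < t → d * Real.log s + g / s ≤ d * Real.log t + g / t) ↔ s = g / d := by
  constructor
  · intro h
    have hmin : IsLocalMin (fun t => d * Real.log t + g * t⁻¹) s := by
      filter_upwards [lt_mem_nhds hs] with t ht
      simpa only [div_eq_mul_inv] using h t ht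
    have hderiv : HasDerivAt (fun t => d * Real.log t + g * t⁻¹)
        (d * s⁻¹ + g * (-(s ^ 2)⁻¹)) s :=
      ((Real.hasDerivAt_log hs.ne').const_mul d).add ((hasDerivAt_inv hs.ne').const_mul g)
    have hcritical := hmin.hasDerivAt_eq_zero hderiv
    field_simp at hcritical
    rw [eq_div_iff hd.ne']
    linarith
  · intro hsg t ht
    obtain rfl : g = d * s := by rw [hsg]; field_simp
    have hlog := Real.log_le_sub_one_of_pos (div_pos hs ht)
    rw [Real.log_div hs.ne' ht.ne'] at hlog
    calc d * Real.log s + d * s / s = d * (Real.log s + 1) := by field_simp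
      _ ≤ d * (Real.log t + s / t) := mul_le_mul_of_nonneg_left (by linarith) hd.le
      _ = d * Real.log t + d * s / t := by ring

end LogScale

section Model

open Module (finrank)

variable {r : ℕ} {n m : Fin r → ℕ} {θ : Params n m} {Ω : Type*} [MeasurableSpace Ω]
  {P : Measure Ω}

theorem finrank_tensor (n : Fin r → ℕ) : (finrank ℝ (Tensor n) : ℝ) = dim n := by
  simp [dim]

theorem normalDensity_eq_isotropicDensity (v : ℝ) (μ x : Tensor n) :
    normalDensity v μ x = isotropicDensity v (x - μ) := by
  rw [normalDensity, isotropicDensity, finrank_tensor]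

theorem continuous_jointDensity (θ : Params n m) :
    Continuous fun p : Tensor n × Tensor m => jointDensity θ p.1 p.2 := by
  have hF : Continuous (tucker θ.A) := LinearMap.continuous_of_finiteDimensional _
  unfold jointDensity normalDensity
  fun_prop

theorem jointDensity_eq_linearGaussianDensity (θ : Params n m) (x : Tensor n) (z : Tensor m) :
    jointDensity θ x z = linearGaussianDensity (tucker θ.A) θ.sigmaSq (x - θ.mu) z := by
  rw [jointDensity, linearGaussianDensity, normalDensity_eq_isotropicDensity,
    normalDensity_eq_isotropicDensity, sub_zero, sub_sub]

theorem latentPosterior_eq_posterior (θ : Params n m) (x : Tensor n) :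
    latentPosterior θ x = posterior (tucker θ.A) θ.sigmaSq (x - θ.mu) := by
  simp only [latentPosterior, posterior, jointDensity_eq_linearGaussianDensity]

theorem isGaussian_latentPosterior (θ : Params n m) (x : Tensor n) :
    IsGaussian (latentPosterior θ x) := by
  rw [latentPosterior_eq_posterior]
  exact isGaussian_posterior _ θ.sigmaSq_pos _

theorem integral_id_latentPosterior (θ : Params n m) (x : Tensor n) :
    ∫ z, z ∂(latentPosterior θ x) = eMean θ x := by
  rw [latentPosterior_eq_posterior, integral_id_posterior _ θ.sigmaSq_pos]
  rfl

theorem covarianceBilin_latentPosterior (θ : Params n m) (x : Tensor n) (S T : Tensor m) :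
    covarianceBilin (latentPosterior θ x) S T = inner ℝ (eCov θ S) T := by
  rw [latentPosterior_eq_posterior, covarianceBilin_posterior _ θ.sigmaSq_pos]
  rfl

theorem integral_inner_mul_inner_latentPosterior (θ : Params n m) (x : Tensor n)
    (S T : Tensor m) :
    ∫ z, inner ℝ (z - eMean θ x) S * inner ℝ (z - eMean θ x) T ∂(latentPosterior θ x) =
      inner ℝ (eCov θ S) T := by
  have := isGaussian_latentPosterior θ x
  rw [← covarianceBilin_latentPosterior θ x, covarianceBilin_apply IsGaussian.memLp_two_id]
  simp only [id, integral_id_latentPosterior, real_inner_comm S, real_inner_comm T]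

theorem IsNormalTensor.map_eq_isotropicGaussian [IsProbabilityMeasure P] {Y : Ω → Tensor n}
    {v : ℝ} (hv : 0 ≤ v) (hY : IsNormalTensor P Y 0 (v • LinearMap.id)) :
    P.map Y = isotropicGaussian (Tensor n) v := by
  refine eq_isotropicGaussian_of_forall_map_inner hv fun t => ?_
  have ht := hY.2 t
  rw [inner_zero_left, LinearMap.smul_apply, real_inner_smul_left, LinearMap.id_apply,
    real_inner_self_eq_norm_sq] at ht
  rw [Measure.map_map (by fun_prop) hY.1]
  exact ht

theorem IsNormalTensor.memLp_two [IsProbabilityMeasure P] {Y : Ω → Tensor n} {v : ℝ}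
    (hv : 0 ≤ v) (hY : IsNormalTensor P Y 0 (v • LinearMap.id)) : MemLp Y 2 P := by
  have hgaussian := isGaussian_isotropicGaussian (E := Tensor n) v
  rw [← hY.map_eq_isotropicGaussian hv] at hgaussian
  exact (memLp_map_measure_iff aestronglyMeasurable_id hY.1.aemeasurable).1
    IsGaussian.memLp_two_id

variable {X : Ω → Tensor n} {Z : Ω → Tensor m}

theorem IsTPCA.measurable_latent (h : IsTPCA P θ X Z) : Measurable Z :=
  h.choose_spec.1.1

theorem IsTPCA.measurable_obs (h : IsTPCA P θ X Z) : Measurable X := by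
  obtain ⟨ε, hZ, hε, -, hX⟩ := h
  have hF : Continuous (tucker θ.A) := LinearMap.continuous_of_finiteDimensional _
  rw [funext hX]
  exact ((hF.measurable.comp hZ.1).const_add _).add hε.1

variable [IsProbabilityMeasure P]

theorem IsTPCA.memLp_latent (h : IsTPCA P θ X Z) : MemLp Z 2 P := by
  obtain ⟨ε, hZ, -⟩ := h
  rw [← one_smul ℝ LinearMap.id] at hZ
  exact hZ.memLp_two zero_le_one

theorem IsTPCA.memLp_obs (h : IsTPCA P θ X Z) : MemLp X 2 P := by
  have hZ := h.memLp_latent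
  obtain ⟨ε, -, hε, -, hX⟩ := h
  have hFZ : MemLp (fun ω => tucker θ.A (Z ω)) 2 P :=
    (tucker θ.A).toContinuousLinearMap.comp_memLp' hZ
  rw [funext hX]
  exact ((memLp_const θ.mu).add hFZ).add (hε.memLp_two θ.sigmaSq_pos.le)

theorem IsTPCA.map_obs_sub_mu_prodMk (h : IsTPCA P θ X Z) :
    P.map (fun ω => (X ω - θ.mu, Z ω)) = linearGaussianLaw (tucker θ.A) θ.sigmaSq := by
  obtain ⟨ε, hZ, hε, hindep, hX⟩ := h
  have hF : Continuous (tucker θ.A) := LinearMap.continuous_of_finiteDimensional _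
  have hZε := (indepFun_iff_map_prod_eq_prod_map_map hZ.1.aemeasurable hε.1.aemeasurable).1 hindep
  rw [← one_smul ℝ LinearMap.id] at hZ
  rw [hZ.map_eq_isotropicGaussian zero_le_one,
    hε.map_eq_isotropicGaussian θ.sigmaSq_pos.le] at hZε
  rw [← map_isotropicGaussian_prod _ θ.sigmaSq_pos, ← hZε,
    Measure.map_map (by fun_prop) (hZ.1.prodMk hε.1)]
  congr 1
  funext ω
  rw [hX, add_assoc, add_sub_cancel_left, Function.comp_apply]

theorem IsTPCA.map_prodMk (h : IsTPCA P θ X Z) :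
    P.map (fun ω => (X ω, Z ω)) =
      (volume.prod volume).withDensity fun p => ENNReal.ofReal (jointDensity θ p.1 p.2) := by
  have htranslate : MeasurePreserving (fun p : Tensor n × Tensor m => (p.1 + θ.mu, p.2))
      (volume.prod volume) (volume.prod volume) :=
    (measurePreserving_add_right volume θ.mu).prod (MeasurePreserving.id volume)
  have hdensity : Measurable fun p : Tensor n × Tensor m =>
      ENNReal.ofReal (jointDensity θ p.1 p.2) :=
    (continuous_jointDensity θ).measurable.ennreal_ofReal
  have hlaw := congrArg (Measure.map fun p => (p.1 + θ.mu, p.2)) h.map_obs_sub_mu_prodMk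
  rw [Measure.map_map htranslate.measurable
    ((h.measurable_obs.sub_const _).prodMk h.measurable_latent)] at hlaw
  simp only [Function.comp_def, sub_add_cancel] at hlaw
  rw [hlaw, ← map_withDensity_comp htranslate hdensity, linearGaussianLaw]
  simp only [Function.comp_def, jointDensity_eq_linearGaussianDensity, add_sub_cancel_right]

end Model

section EStep

variable {r : ℕ} {n m : Fin r → ℕ} {θ₀ : Params n m} {Ω : Type*} [MeasurableSpace Ω]
  {P : Measure Ω} [IsProbabilityMeasure P] {X : Ω → Tensor n} {Z : Ω → Tensor m}

theorem IsTPCA.indepFun_sub_gain (h : IsTPCA P θ₀ X Z) :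
    IndepFun X (fun ω => Z ω - gain (tucker θ₀.A) θ₀.sigmaSq (X ω - θ₀.mu)) P := by
  have hindep := TPCA.indepFun_sub_gain (tucker θ₀.A) θ₀.sigmaSq_pos
    (h.measurable_obs.sub_const θ₀.mu) h.measurable_latent h.map_obs_sub_mu_prodMk
  simpa only [Function.comp_def, sub_add_cancel, id] using
    hindep.comp (measurable_add_const θ₀.mu) measurable_id

theorem IsTPCA.condExp_comp_prodMk {G : Type*} [NormedAddCommGroup G] [NormedSpace ℝ G]
    [CompleteSpace G] (h : IsTPCA P θ₀ X Z) {f : Tensor n × Tensor m → G}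
    (hf : StronglyMeasurable f) (hfi : Integrable (fun ω => f (X ω, Z ω)) P) :
    P[fun ω => f (X ω, Z ω) | MeasurableSpace.comap X inferInstance] =ᵐ[P]
      fun ω => ∫ z, f (X ω, z) ∂(latentPosterior θ₀ (X ω)) := by
  simp only [latentPosterior_eq_posterior]
  exact condExp_comp_prodMk_latent (tucker θ₀.A) θ₀.sigmaSq_pos h.measurable_obs
    (measurable_id.sub_const θ₀.mu) h.measurable_latent h.map_obs_sub_mu_prodMk
    h.indepFun_sub_gain hf hfi

theorem IsTPCA.condExp_latent (h : IsTPCA P θ₀ X Z) :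
    P[Z | MeasurableSpace.comap X inferInstance] =ᵐ[P] fun ω => eMean θ₀ (X ω) := by
  simpa only [integral_id_latentPosterior] using
    h.condExp_comp_prodMk measurable_snd.stronglyMeasurable (h.memLp_latent.integrable one_le_two)

theorem continuous_eMean (θ : Params n m) : Continuous (eMean θ) :=
  (LinearMap.continuous_of_finiteDimensional (gain (tucker θ.A) θ.sigmaSq)).comp
    (continuous_id.sub continuous_const)

theorem IsTPCA.memLp_inner_latent_sub_eMean (h : IsTPCA P θ₀ X Z) (S : Tensor m) :
    MemLp (fun ω => inner ℝ (Z ω - eMean θ₀ (X ω)) S) 2 P := by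
  have hmean : MemLp (fun ω => eMean θ₀ (X ω)) 2 P :=
    (gain (tucker θ₀.A) θ₀.sigmaSq).toContinuousLinearMap.comp_memLp'
      (h.memLp_obs.sub (memLp_const θ₀.mu))
  simp only [real_inner_comm S]
  exact (innerSL ℝ S).comp_memLp' (h.memLp_latent.sub hmean)

theorem IsTPCA.condExp_inner_mul_inner_latent (h : IsTPCA P θ₀ X Z) (S T : Tensor m) :
    P[fun ω =>
        inner ℝ (Z ω - (P[Z | MeasurableSpace.comap X inferInstance]) ω) S *
        inner ℝ (Z ω - (P[Z | MeasurableSpace.comap X inferInstance]) ω) T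
      | MeasurableSpace.comap X inferInstance] =ᵐ[P]
      fun _ => inner ℝ (eCov θ₀ S) T := by
  have hmean := continuous_eMean θ₀
  have hcov := h.condExp_comp_prodMk
    (f := fun p => inner ℝ (p.2 - eMean θ₀ p.1) S * inner ℝ (p.2 - eMean θ₀ p.1) T)
    (by fun_prop : Continuous _).stronglyMeasurable
    ((h.memLp_inner_latent_sub_eMean S).integrable_mul (h.memLp_inner_latent_sub_eMean T))
  simp only [integral_inner_mul_inner_latentPosterior] at hcov
  refine (condExp_congr_ae ?_).trans hcov
  filter_upwards [h.condExp_latent] with ω hω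
  rw [hω]

theorem IsTPCA.integrable_log_jointDensity (h : IsTPCA P θ₀ X Z) (θ : Params n m) :
    Integrable (fun ω => Real.log (jointDensity θ (X ω) (Z ω))) P := by
  simp only [jointDensity_eq_linearGaussianDensity]
  exact integrable_log_linearGaussianDensity _ θ.sigmaSq_pos
    (h.memLp_obs.sub (memLp_const θ.mu)) h.memLp_latent

variable {N : ℕ} {Xs : Fin N → Ω → Tensor n} {Zs : Fin N → Ω → Tensor m}

theorem IsTPCASample.integrable_logLik (h : IsTPCASample P θ₀ Xs Zs) (θ : Params n m) :
    Integrable (fun ω => logLik θ (fun i => Xs i ω) (fun i => Zs i ω)) P :=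
  integrable_finsetSum _ fun i _ => (h.1 i).integrable_log_jointDensity θ

theorem IsTPCASample.indepFun_sub_gain (h : IsTPCASample P θ₀ Xs Zs) (i : Fin N) :
    IndepFun (fun ω j => Xs j ω)
      (fun ω => Zs i ω - gain (tucker θ₀.A) θ₀.sigmaSq (Xs i ω - θ₀.mu)) P := by
  have hK : Continuous (gain (tucker θ₀.A) θ₀.sigmaSq) :=
    LinearMap.continuous_of_finiteDimensional _
  have hresidual : Measurable fun p : Tensor n × Tensor m =>
      (p.1, p.2 - gain (tucker θ₀.A) θ₀.sigmaSq (p.1 - θ₀.mu)) := by fun_prop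
  have hpairs := h.2.comp (fun _ => _) fun _ => hresidual
  exact (indepFun_pi_of_iIndepFun_prodMk (fun j => (h.1 j).measurable_obs)
    (fun j => measurable_snd.comp
      (hresidual.comp ((h.1 j).measurable_obs.prodMk (h.1 j).measurable_latent)))
    hpairs fun j => (h.1 j).indepFun_sub_gain).comp measurable_id (measurable_pi_apply i)

theorem IsTPCASample.condExp_log_jointDensity (h : IsTPCASample P θ₀ Xs Zs) (θ : Params n m)
    (i : Fin N) :
    P[fun ω => Real.log (jointDensity θ (Xs i ω) (Zs i ω))
      | MeasurableSpace.comap (fun ω j => Xs j ω) inferInstance] =ᵐ[P]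
      fun ω => ∫ z, Real.log (jointDensity θ (Xs i ω) z) ∂(latentPosterior θ₀ (Xs i ω)) := by
  simp only [latentPosterior_eq_posterior]
  have hpair : Measurable fun p : (Fin N → Tensor n) × Tensor m => (p.1 i, p.2) := by fun_prop
  have hlog : Measurable fun p : (Fin N → Tensor n) × Tensor m =>
      Real.log (jointDensity θ (p.1 i) p.2) :=
    ((continuous_jointDensity θ).measurable.comp hpair).log
  exact condExp_comp_prodMk_latent (tucker θ₀.A) θ₀.sigmaSq_pos
    (measurable_pi_lambda _ fun j => (h.1 j).measurable_obs)
    (by fun_prop : Measurable fun x : Fin N → Tensor n => x i - θ₀.mu)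
    (h.1 i).measurable_latent (h.1 i).map_obs_sub_mu_prodMk (h.indepFun_sub_gain i)
    hlog.stronglyMeasurable ((h.1 i).integrable_log_jointDensity θ)

theorem IsTPCASample.condExp_logLik (h : IsTPCASample P θ₀ Xs Zs) (θ : Params n m) :
    P[fun ω => logLik θ (fun i => Xs i ω) (fun i => Zs i ω)
      | MeasurableSpace.comap (fun ω i => Xs i ω) inferInstance] =ᵐ[P]
      fun ω => emQ (fun i => Xs i ω) θ₀ θ := by
  have hsum := condExp_finsetSum (μ := P) (s := Finset.univ)
    (fun i _ => (h.1 i).integrable_log_jointDensity θ)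
    (MeasurableSpace.comap (fun ω i => Xs i ω) inferInstance)
  have hlogLik : (fun ω => logLik θ (fun i => Xs i ω) (fun i => Zs i ω)) =
      ∑ i, fun ω => Real.log (jointDensity θ (Xs i ω) (Zs i ω)) := by
    funext ω
    rw [logLik, Finset.sum_apply]
  rw [hlogLik]
  filter_upwards [hsum, ae_all_iff.2 (h.condExp_log_jointDensity θ)] with ω hω hterms
  rw [hω, Finset.sum_apply, emQ]
  exact Finset.sum_congr rfl fun i _ => hterms i

end EStep

section EMObjective

variable {r : ℕ} {n m : Fin r → ℕ} {N : ℕ}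

theorem integrable_log_jointDensity_latentPosterior (θ₀ θ : Params n m) (x : Tensor n) :
    Integrable (fun z => Real.log (jointDensity θ x z)) (latentPosterior θ₀ x) := by
  have := isGaussian_latentPosterior θ₀ x
  simp only [jointDensity_eq_linearGaussianDensity]
  exact integrable_log_linearGaussianDensity _ θ.sigmaSq_pos (memLp_const _)
    IsGaussian.memLp_two_id

theorem integral_log_jointDensity_latentPosterior (θ₀ θ : Params n m) (x : Tensor n) :
    ∫ z, Real.log (jointDensity θ x z) ∂(latentPosterior θ₀ x) =
      -((dim n + dim m) / 2 * Real.log (2 * Real.pi)) - dim n / 2 * Real.log θ.sigmaSq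
        - 1 / 2 * (‖eMean θ₀ x‖ ^ 2 + LinearMap.trace ℝ (Tensor m) (eCov θ₀))
        - 1 / (2 * θ.sigmaSq) * (‖x - θ.mu - tucker θ.A (eMean θ₀ x)‖ ^ 2
          + traceTerm (eCov θ₀) θ.A) := by
  have := isGaussian_latentPosterior θ₀ x
  simp only [jointDensity_eq_linearGaussianDensity]
  rw [integral_log_linearGaussianDensity _ θ.sigmaSq_pos IsGaussian.memLp_two_id
    (covarianceBilin_latentPosterior θ₀ x), integral_id_latentPosterior, finrank_tensor,
    finrank_tensor, traceTerm]

theorem emQ_eq (x : Fin N → Tensor n) (θ₀ θ : Params n m) :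
    emQ x θ₀ θ =
      -(N * (dim n + dim m) / 2 * Real.log (2 * Real.pi))
      - 1 / 2 * ∑ i, ‖eMean θ₀ (x i)‖ ^ 2
      - dim n * N / 2 * Real.log θ.sigmaSq
      - 1 / (2 * θ.sigmaSq) * rss x (fun i => eMean θ₀ (x i)) θ.A θ.mu
      - N / 2 * LinearMap.trace ℝ (Tensor m) (eCov θ₀)
      - N / (2 * θ.sigmaSq) * traceTerm (eCov θ₀) θ.A := by
  rw [emQ, rss]
  simp only [integral_log_jointDensity_latentPosterior, Finset.sum_sub_distrib, ← Finset.mul_sum,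
    Finset.sum_add_distrib, Finset.sum_const, Finset.card_univ, Fintype.card_fin, nsmul_eq_mul]
  ring

theorem emQ_eq_sub_mObjective (hN : 0 < N) (x : Fin N → Tensor n) (θ₀ θ : Params n m) :
    emQ x θ₀ θ =
      (-(N * (dim n + dim m) / 2 * Real.log (2 * Real.pi))
        - 1 / 2 * ∑ i, ‖eMean θ₀ (x i)‖ ^ 2
        - N / 2 * LinearMap.trace ℝ (Tensor m) (eCov θ₀))
      - N / 2 * (dim n * Real.log θ.sigmaSq + mObjective x θ₀ θ.A θ.mu / θ.sigmaSq) := by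
  have hs := θ.sigmaSq_pos
  have : (0 : ℝ) < N := Nat.cast_pos.2 hN
  rw [emQ_eq, mObjective]
  field_simp
  ring

theorem emQ_le_iff (hN : 0 < N) (x : Fin N → Tensor n) (θ₀ θ θ' : Params n m) :
    emQ x θ₀ θ' ≤ emQ x θ₀ θ ↔
      dim n * Real.log θ.sigmaSq + mObjective x θ₀ θ.A θ.mu / θ.sigmaSq ≤
        dim n * Real.log θ'.sigmaSq + mObjective x θ₀ θ'.A θ'.mu / θ'.sigmaSq := by
  have hN' : (0 : ℝ) < N / 2 := half_pos (Nat.cast_pos.2 hN)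
  rw [emQ_eq_sub_mObjective hN, emQ_eq_sub_mObjective hN, sub_le_sub_iff_left,
    mul_le_mul_iff_right₀ hN']

theorem emQ_le_iff_mObjective_le (hN : 0 < N) (x : Fin N → Tensor n) (θ₀ : Params n m)
    {s : ℝ} (hs : 0 < s) (A A' : Factors n m) (ν ν' : Tensor m) :
    emQ x θ₀ ⟨A', ν', s, hs⟩ ≤ emQ x θ₀ ⟨A, ν, s, hs⟩ ↔
      mObjective x θ₀ A (tucker A ν) ≤ mObjective x θ₀ A' (tucker A' ν') := by
  rw [emQ_le_iff hN, add_le_add_iff_left, div_le_div_iff_of_pos_right hs]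
  rfl

end EMObjective

section MStep

variable {r : ℕ} {n m : Fin r → ℕ} {N : ℕ}

theorem mObjective_tucker_le_iff (hN : 0 < N) (x : Fin N → Tensor n) (θ₀ : Params n m)
    (A : Factors n m) (ν ν' : Tensor m) :
    mObjective x θ₀ A (tucker A ν) ≤ mObjective x θ₀ A (tucker A ν') ↔
      ∑ i, ‖x i - tucker A (eMean θ₀ (x i)) - tucker A ν‖ ^ 2 ≤
        ∑ i, ‖x i - tucker A (eMean θ₀ (x i)) - tucker A ν'‖ ^ 2 := by
  have hN' : (0 : ℝ) < 1 / N := one_div_pos.2 (Nat.cast_pos.2 hN)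
  simp only [mObjective, rss, add_le_add_iff_right, mul_le_mul_iff_right₀ hN',
    sub_right_comm _ _ (tucker A (eMean θ₀ _))]

theorem forall_mObjective_le_iff (hN : 0 < N) (x : Fin N → Tensor n) (θ₀ : Params n m)
    {A : Factors n m} (hA : IsUnit (gram A)) (ν : Tensor m) :
    (∀ ν', mObjective x θ₀ A (tucker A ν) ≤ mObjective x θ₀ A (tucker A ν')) ↔
      ν = nuUpdate x θ₀ A := by
  have : Nonempty (Fin N) := Fin.pos_iff_nonempty.1 hN
  have hleast := forall_sum_norm_sub_sq_le_iff hA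
    (fun i => x i - tucker A (eMean θ₀ (x i))) ν
  rw [Fintype.card_fin] at hleast
  simp only [mObjective_tucker_le_iff hN]
  exact hleast

theorem dim_pos (hn : ∀ k, 0 < n k) : 0 < dim n :=
  Nat.cast_pos.2 (Finset.prod_pos fun k _ => hn k)

theorem sigmaSqUpdate_eq_div (x : Fin N → Tensor n) (θ₀ : Params n m) (A : Factors n m)
    (μ : Tensor n) : sigmaSqUpdate x θ₀ A μ = mObjective x θ₀ A μ / dim n := by
  rw [sigmaSqUpdate, mObjective, one_div_mul_eq_div, one_div_mul_eq_div, one_div_mul_eq_div,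
    add_div, div_div, mul_comm (N : ℝ)]

theorem forall_emQ_le_iff_eq_nuUpdate (hN : 0 < N) (x : Fin N → Tensor n) (θ₀ : Params n m)
    {s : ℝ} (hs : 0 < s) {A : Factors n m} (hA : IsUnit (gram A)) (ν : Tensor m) :
    (∀ ν', emQ x θ₀ ⟨A, ν', s, hs⟩ ≤ emQ x θ₀ ⟨A, ν, s, hs⟩) ↔ ν = nuUpdate x θ₀ A := by
  simp only [emQ_le_iff_mObjective_le hN, forall_mObjective_le_iff hN x θ₀ hA]

theorem forall_emQ_le_iff_eq_sigmaSqUpdate (hn : ∀ k, 0 < n k) (hN : 0 < N)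
    (x : Fin N → Tensor n) (θ₀ : Params n m) {s : ℝ} (hs : 0 < s) (A : Factors n m)
    (ν : Tensor m) :
    (∀ (s' : ℝ) (hs' : 0 < s'), emQ x θ₀ ⟨A, ν, s', hs'⟩ ≤ emQ x θ₀ ⟨A, ν, s, hs⟩) ↔
      s = sigmaSqUpdate x θ₀ A (tucker A ν) := by
  rw [sigmaSqUpdate_eq_div, ← forall_mul_log_add_div_le_iff (dim_pos hn) _ hs]
  exact forall₂_congr fun s' hs' => emQ_le_iff hN x θ₀ _ _

theorem IsProcedureStep.isEMStep (hn : ∀ k, 0 < n k) (hN : 0 < N) {x : Fin N → Tensor n}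
    {θ₀ θ : Params n m} (h : IsProcedureStep x θ₀ θ) : IsEMStep x θ₀ θ := by
  obtain ⟨⟨ν, hν⟩, hregular, hsingular, hσ⟩ := h
  have hmin : ∀ ν', mObjective x θ₀ θ.A (tucker θ.A θ.nu) ≤
      mObjective x θ₀ θ.A (tucker θ.A ν') := by
    by_cases hA : IsUnit (gram θ.A)
    · exact (forall_mObjective_le_iff hN x θ₀ hA _).2 (hregular hA)
    · exact hsingular hA
  intro θ'
  calc emQ x θ₀ θ'
      ≤ emQ x θ₀ ⟨θ.A, θ.nu, θ'.sigmaSq, θ'.sigmaSq_pos⟩ :=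
        (emQ_le_iff_mObjective_le hN x θ₀ θ'.sigmaSq_pos θ.A θ'.A θ.nu θ'.nu).2
          ((hmin ν).trans (hν _ _))
    _ ≤ emQ x θ₀ θ :=
        (forall_emQ_le_iff_eq_sigmaSqUpdate hn hN x θ₀ θ.sigmaSq_pos θ.A θ.nu).2 hσ _ _

theorem IsEMStep.isProcedureStep (hn : ∀ k, 0 < n k) (hN : 0 < N) {x : Fin N → Tensor n}
    {θ₀ θ : Params n m} (h : IsEMStep x θ₀ θ) : IsProcedureStep x θ₀ θ := by
  have hmin : ∀ (A' : Factors n m) (ν' : Tensor m),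
      mObjective x θ₀ θ.A (tucker θ.A θ.nu) ≤ mObjective x θ₀ A' (tucker A' ν') :=
    fun A' ν' => (emQ_le_iff_mObjective_le hN x θ₀ θ.sigmaSq_pos θ.A A' θ.nu ν').1 (h _)
  exact ⟨⟨θ.nu, hmin⟩, fun hA => (forall_mObjective_le_iff hN x θ₀ hA _).1 (hmin θ.A),
    fun _ => hmin θ.A,
    (forall_emQ_le_iff_eq_sigmaSqUpdate hn hN x θ₀ θ.sigmaSq_pos θ.A θ.nu).1 fun _ _ => h _⟩

theorem isProcedureStep_iff_isEMStep (hn : ∀ k, 0 < n k) (hN : 0 < N)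
    (x : Fin N → Tensor n) (θ₀ θ : Params n m) :
    IsProcedureStep x θ₀ θ ↔ IsEMStep x θ₀ θ :=
  ⟨IsProcedureStep.isEMStep hn hN, IsEMStep.isProcedureStep hn hN⟩

end MStep

end

end TPCA

theorem mainTheorem7 {r : ℕ} {n m : Fin r → ℕ} (hn : ∀ k, 0 < n k) {N : ℕ} (hN : 0 < N) :
    -- E-step: complete-data law, conditional mean and covariance, and the EM objective
    (∀ (Ω : Type*) [MeasurableSpace Ω] (P : Measure Ω) [IsProbabilityMeasure P]
        (θ₀ : Params n m) (X : Fin N → Ω → Tensor n) (Z : Fin N → Ω → Tensor m),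
      IsTPCASample P θ₀ X Z →
      (∀ i, P.map (fun ω => (X i ω, Z i ω)) =
        ((volume : Measure (Tensor n)).prod (volume : Measure (Tensor m))).withDensity
          fun p => ENNReal.ofReal (jointDensity θ₀ p.1 p.2)) ∧
      (∀ i, Integrable (Z i) P ∧
        P[Z i | MeasurableSpace.comap (X i) inferInstance] =ᵐ[P]
          fun ω => eMean θ₀ (X i ω)) ∧
      (∀ i (S T : Tensor m),
        P[fun ω =>
            inner ℝ (Z i ω - (P[Z i | MeasurableSpace.comap (X i) inferInstance]) ω) S *
            inner ℝ (Z i ω - (P[Z i | MeasurableSpace.comap (X i) inferInstance]) ω) T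
          | MeasurableSpace.comap (X i) inferInstance] =ᵐ[P]
          fun _ => inner ℝ (eCov θ₀ S) T) ∧
      (∀ θ : Params n m,
        Integrable (fun ω => logLik θ (fun i => X i ω) (fun i => Z i ω)) P ∧
        P[fun ω => logLik θ (fun i => X i ω) (fun i => Z i ω)
          | MeasurableSpace.comap (fun ω i => X i ω) inferInstance] =ᵐ[P]
          fun ω => emQ (fun i => X i ω) θ₀ θ)) ∧
    -- For every data set and every current parameter
    (∀ (x : Fin N → Tensor n) (θ₀ : Params n m),
      IsUnit (opM θ₀) ∧
      -- mean and covariance of the conditional law of the latent tensor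
      (∀ i, IsProbabilityMeasure (latentPosterior θ₀ (x i)) ∧
        Integrable (fun z => z) (latentPosterior θ₀ (x i)) ∧
        ∫ z, z ∂(latentPosterior θ₀ (x i)) = eMean θ₀ (x i) ∧
        ∀ S T : Tensor m,
          ∫ z, inner ℝ (z - eMean θ₀ (x i)) S * inner ℝ (z - eMean θ₀ (x i)) T
            ∂(latentPosterior θ₀ (x i)) = inner ℝ (eCov θ₀ S) T) ∧
      -- the expected complete-data log-likelihood
      (∀ θ : Params n m,
        (∀ i, Integrable (fun z => Real.log (jointDensity θ (x i) z)) (latentPosterior θ₀ (x i))) ∧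
        emQ x θ₀ θ =
          -(N * (dim n + dim m) / 2 * Real.log (2 * Real.pi))
          - 1 / 2 * ∑ i, ‖eMean θ₀ (x i)‖ ^ 2
          - dim n * N / 2 * Real.log θ.sigmaSq
          - 1 / (2 * θ.sigmaSq) * rss x (fun i => eMean θ₀ (x i)) θ.A θ.mu
          - N / 2 * LinearMap.trace ℝ (Tensor m) (eCov θ₀)
          - N / (2 * θ.sigmaSq) * traceTerm (eCov θ₀) θ.A) ∧
      -- increasing it in `(A, ν)` is the same as decreasing the M-step objective
      (∀ (s : ℝ) (hs : 0 < s) (A A' : Factors n m) (ν ν' : Tensor m),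
        emQ x θ₀ ⟨A', ν', s, hs⟩ ≤ emQ x θ₀ ⟨A, ν, s, hs⟩ ↔
          mObjective x θ₀ A (tucker A ν) ≤ mObjective x θ₀ A' (tucker A' ν')) ∧
      -- the update of `ν` is the unique maximizer in `ν`
      (∀ (s : ℝ) (hs : 0 < s) (A : Factors n m) (ν : Tensor m), IsUnit (gram A) →
        ((∀ ν' : Tensor m, emQ x θ₀ ⟨A, ν', s, hs⟩ ≤ emQ x θ₀ ⟨A, ν, s, hs⟩) ↔
          ν = nuUpdate x θ₀ A)) ∧
      -- the update of `σ²` is the unique maximizer in `σ²`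
      (∀ (s : ℝ) (hs : 0 < s) (A : Factors n m) (ν : Tensor m),
        (∀ (s' : ℝ) (hs' : 0 < s'), emQ x θ₀ ⟨A, ν, s', hs'⟩ ≤ emQ x θ₀ ⟨A, ν, s, hs⟩) ↔
          s = sigmaSqUpdate x θ₀ A (tucker A ν)) ∧
      -- one round of the procedure is one EM step
      (∀ θ : Params n m, IsProcedureStep x θ₀ θ ↔ IsEMStep x θ₀ θ)) ∧
    -- the runs of the procedure are the runs of the EM algorithm
    (∀ (x : Fin N → Tensor n) (θ : ℕ → Params n m),
      (∀ t, IsProcedureStep x (θ t) (θ (t + 1))) ↔ (∀ t, IsEMStep x (θ t) (θ (t + 1)))) := by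
  refine ⟨fun Ω _ P _ θ₀ X Z h => ⟨fun i => (h.1 i).map_prodMk,
      fun i => ⟨(h.1 i).memLp_latent.integrable one_le_two, (h.1 i).condExp_latent⟩,
      fun i => (h.1 i).condExp_inner_mul_inner_latent,
      fun θ => ⟨h.integrable_logLik θ, h.condExp_logLik θ⟩⟩,
    fun x θ₀ => ⟨isUnit_precision _ θ₀.sigmaSq_pos, fun i => ?_,
      fun θ => ⟨fun i => integrable_log_jointDensity_latentPosterior θ₀ θ _, emQ_eq x θ₀ θ⟩,
      fun s hs => emQ_le_iff_mObjective_le hN x θ₀ hs,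
      fun s hs A ν hA => forall_emQ_le_iff_eq_nuUpdate hN x θ₀ hs hA ν,
      fun s hs => forall_emQ_le_iff_eq_sigmaSqUpdate hn hN x θ₀ hs,
      isProcedureStep_iff_isEMStep hn hN x θ₀⟩,
    fun x θ => forall_congr' fun t => isProcedureStep_iff_isEMStep hn hN x _ _⟩
  have := isGaussian_latentPosterior θ₀ (x i)
  exact ⟨inferInstance, IsGaussian.memLp_two_id.integrable one_le_two,
    integral_id_latentPosterior θ₀ _, integral_inner_mul_inner_latentPosterior θ₀ _⟩
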